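/- Let $m\ge 4$ and let $K_m$ be the 1-dimensional skeleton of the full simplex on the vertex set $V_m=\{1,\dots,m\}$, so that $|K_m|$ is the complete graph on $m$ vertices. Let $C_m$ be Munkres' simplicial model of $\mathrm{Conf}(|K_m|,2)$: the subcomplex of the ordered product $K_m\times K_m$ consisting of the simplices whose realization is disjoint from that of the diagonal. Its vertices are the columns $\genfrac{}{}{0pt}{1}{a}{b}$ with $a,b\in V_m$, $a\ne b$, and its $k$-simplices are the matrices $$\begin{bmatrix} v_{0,1} & \cdots & v_{k,1}\\ v_{0,2} & \cdots & v_{k,2}\end{bmatrix}$$ with entries in $V_m$ whose rows are weakly increasing, whose consecutive columns are different, whose rows each take at most two values, and with $v_{j,1}\neq v_{j,2}$ for all $j$. Order the vertices of $C_m$ lexicographically. Let $W_m$ be the matching (a discrete gradient field) on the face poset of $C_m$ constructed by the following algorithm, applied to $C_m$. Given a finite simplicial complex of dimension $d$ with linearly ordered vertices, start with no pairings. For $i=d-1,\dots,1,0$ (in this order; a value of $i$ is skipped if at that moment no $i$-face or no $(i+1)$-face is unpaired), for $r=i+1,i,\dots,0$ (in this order), for all vertices $v$ from the largest to the smallest,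 and for all $i$-faces $\alpha$ in the lexicographic order of their increasing vertex tuples: if $\alpha\cup\{v\}$ is an $(i+1)$-face in which $v$ appears in position $r$ (positions being counted from $0$), and if neither $\alpha$ nor $\alpha\cup\{v\}$ has been paired so far, add the pairing $\alpha\nearrow\alpha\cup\{v\}$. A face is critical if it takes part in no pairing. Below, every displayed matrix is understood to be a simplex of $C_m$ with its columns in the displayed order; the conditions on the entries that this imposes are omitted. The full list of $W_m$-pairings is: (a) $\begin{bmatrix} a&a\\ b&d\end{bmatrix}\nearrow\begin{bmatrix} a&a&m\\ b&d&d\end{bmatrix}$, for $a<m>d$. (b) $\begin{bmatrix} a&a\\ b&m\end{bmatrix}\nearrow\begin{bmatrix} a&a&m-1\\ b&m&m\end{bmatrix}$, for $a<m-1$. (c) $\begin{bmatrix} a&c\\ b&b\end{bmatrix}\nearrow\begin{bmatrix} a&c&c\\ b&b&m\end{bmatrix}$, for $b<m>c$. (d) $\begin{bmatrix} a&m\\ b&b\end{bmatrix}\nearrow\begin{bmatrix} a&m&m\\ b&b&m-1\end{bmatrix}$, for $b<m-1$. (e) $\begin{bmatrix} a&c\\ b&d\end{bmatrix}\nearrow\begin{bmatrix}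 a&c&c\\ b&b&d\end{bmatrix}$, for $a<c$, $b<d$, $b\ne c$ and either $c<m>d$ or $c=m>d+1$. (f) $\begin{bmatrix} a&c\\ b&d\end{bmatrix}\nearrow\begin{bmatrix} a&a&c\\ b&d&d\end{bmatrix}$, for $a<c$, $b<d$, $a\ne d$ and either $b=c<m>d$ or $c+1<m=d$. (g) $\begin{bmatrix} a\\ b\end{bmatrix}\nearrow\begin{bmatrix} a&m\\ b&m-1\end{bmatrix}$, for either $b<m-1$ or $a<m-1=b$. (h) $\begin{bmatrix} a\\ m\end{bmatrix}\nearrow\begin{bmatrix} a&m-1\\ m&m\end{bmatrix}$, for $a<m-1$. (i) $\begin{bmatrix} m-1\\ m\end{bmatrix}\nearrow\begin{bmatrix} m-1&m-1\\ m-2&m\end{bmatrix}$. The critical faces are exactly: (j) in dimension $0$, the vertex $\begin{bmatrix} m\\ m-1\end{bmatrix}$; (k) in dimension $1$, the simplices (k.1) $\begin{bmatrix} a&m-1\\ b&m\end{bmatrix}$ with either $a=m-1>b+1$ or $a<m-1\ge b$, (k.2) $\begin{bmatrix} m&m\\ b&d\end{bmatrix}$ with $d<m-1$, (k.3) $\begin{bmatrix}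 a&c\\ m&m\end{bmatrix}$ with $c<m-1$; (l) in dimension $2$, the simplices $\begin{bmatrix} a&a&c\\ b&d&d\end{bmatrix}$ with $b\ne c<m>d$. The numbers of critical faces in dimensions $0$, $1$, $2$ are $1$, $2(m-2)^2-1$ and $\frac{(m-1)(m-2)(m-3)(m-4)}{4}$, respectively. -/

import Mathlib

namespace MunkresModel

/-! ### Munkres' model of the ordered configuration space of two points -/

/-- The ordered product of two ordered simplicial complexes. A simplex is a nonempty finite set of
columns `(v, w)` which is a chain for the componentwise order (so that, listed increasingly, its
columns form a matrix with weakly increasing rows and no two consecutive equal columns) and whose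
two rows have a face of `K`, respectively of `L`, as set of entries. -/
def orderedProduct {V U : Type*} [PartialOrder V] [PartialOrder U] [DecidableEq V] [DecidableEq U]
    (K : PreAbstractSimplicialComplex V) (L : PreAbstractSimplicialComplex U) :
    PreAbstractSimplicialComplex (V × U) where
  faces := {σ | σ.Nonempty ∧ IsChain (· ≤ ·) (σ : Set (V × U)) ∧
    σ.image Prod.fst ∈ K.faces ∧ σ.image Prod.snd ∈ L.faces}
  isRelLowerSet_faces := fun {σ} hσ => by
    obtain ⟨h0, h1, h2, h3⟩ := hσ
    refine ⟨h0, fun _ hτ hne => ⟨hne, h1.mono (Finset.coe_subset.mpr hτ), ?_, ?_⟩⟩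
    · exact (K.isRelLowerSet_faces h2).2 (Finset.image_subset_image hτ)
        (Finset.image_nonempty.mpr hne)
    · exact (L.isRelLowerSet_faces h3).2 (Finset.image_subset_image hτ)
        (Finset.image_nonempty.mpr hne)

/-- The diagonal subcomplex of the ordered product `K × K`: the simplices with two equal rows. -/
def diagonal {V : Type*} [PartialOrder V] [DecidableEq V] (K : PreAbstractSimplicialComplex V) :
    PreAbstractSimplicialComplex (V × V) where
  faces := {σ | σ ∈ (orderedProduct K K).faces ∧ ∀ p ∈ σ, p.1 = p.2}
  isRelLowerSet_faces := fun {_} hσ =>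
    ⟨((orderedProduct K K).isRelLowerSet_faces hσ.1).1, fun _ hτ hne =>
      ⟨((orderedProduct K K).isRelLowerSet_faces hσ.1).2 hτ hne, fun p hp => hσ.2 p (hτ hp)⟩⟩

/-- The subcomplex of `X` of all simplices whose realization is disjoint from that of `D`. Since
`|σ| ∩ |τ| = |σ ∩ τ|`, this means that `σ` shares no vertex with any simplex of `D`. -/
def awayFrom {V : Type*} (X D : PreAbstractSimplicialComplex V) :
    PreAbstractSimplicialComplex V where
  faces := {σ | σ ∈ X.faces ∧ ∀ τ ∈ D.faces, Disjoint σ τ}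
  isRelLowerSet_faces := fun {_} hσ =>
    ⟨(X.isRelLowerSet_faces hσ.1).1, fun _ hτ hne =>
      ⟨(X.isRelLowerSet_faces hσ.1).2 hτ hne, fun ρ hρ =>
        Finset.disjoint_of_subset_left hτ (hσ.2 ρ hρ)⟩⟩

/-- Munkres' simplicial model of `Conf(|K|, 2)`. -/
def confModel {V : Type*} [PartialOrder V] [DecidableEq V] (K : PreAbstractSimplicialComplex V) :
    PreAbstractSimplicialComplex (V × V) :=
  awayFrom (orderedProduct K K) (diagonal K)

/-- `K_m`: the 1-skeleton of the full simplex on the vertices `1, …, m`. -/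
def completeGraphComplex (m : ℕ) : PreAbstractSimplicialComplex ℕ where
  faces := {s | s.Nonempty ∧ s ⊆ Finset.Icc 1 m ∧ s.card ≤ 2}
  isRelLowerSet_faces := fun {_} hs =>
    ⟨hs.1, fun _ hτ hne => ⟨hne, hτ.trans hs.2.1, (Finset.card_le_card hτ).trans hs.2.2⟩⟩

/-- `C_m`: Munkres' model of `Conf(|K_m|, 2)`, its vertices `(a, b)` being ordered
lexicographically. -/
def C (m : ℕ) : PreAbstractSimplicialComplex (ℕ ×ₗ ℕ) :=
  (confModel (completeGraphComplex m)).map toLex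

instance finite_faces_C (m : ℕ) : Finite (C m).faces := by
  have h : (confModel (completeGraphComplex m)).faces ⊆
      ((Finset.Icc 1 m ×ˢ Finset.Icc 1 m).powerset : Set (Finset (ℕ × ℕ))) := by
    intro σ hσ
    obtain ⟨⟨-, -, h2, h3⟩, -⟩ := hσ
    simp only [Finset.coe_powerset, Set.mem_preimage, Set.mem_powerset_iff, Finset.coe_subset]
    intro p hp
    exact Finset.mem_product.mpr
      ⟨h2.2.1 (Finset.mem_image_of_mem _ hp), h3.2.1 (Finset.mem_image_of_mem _ hp)⟩
  exact (((Finset.finite_toSet _).subset h).image _).to_subtype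

/-! ### The algorithmic matching of a finite ordered simplicial complex -/

section Algorithm

variable {V : Type*} [LinearOrder V]

/-- The position of `v` in the increasing list of the vertices of `σ`, counted from `0`. -/
def position (v : V) (σ : Finset V) : ℕ := (σ.filter (· < v)).card

/-- The faces of dimension `i` among the faces `F`. -/
def facesOfDim (F : Finset (Finset V)) (i : ℕ) : Finset (Finset V) :=
  F.filter (fun σ => σ.card = i + 1)

/-- The faces of dimension `i` among the faces `F`, in increasing lexicographic order of their
increasingly ordered tuples of vertices. -/
def lexFaces (F : Finset (Finset V)) (i : ℕ) : List (Finset V) :=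
  (((facesOfDim F i).image (fun σ => σ.sort (· ≤ ·))).sort (· ≤ ·)).map List.toFinset

/-- The vertices of the complex with faces `F`, from the largest to the smallest. -/
def verticesDesc (F : Finset (Finset V)) : List V := (F.biUnion id).sort (· ≥ ·)

/-- The state of the algorithm: the pairings constructed so far, and, in every dimension `i`, the
`i`-dimensional faces that take no part in them. -/
structure State (V : Type*) where
  pairs : Finset (Finset V × Finset V)
  free : ℕ → Finset (Finset V)

/-- At the start, there are no pairings and every face is free. -/
def initialState (F : Finset (Finset V)) : State V := ⟨∅, facesOfDim F⟩

/-- The instruction for `i`, `r`, `v`, `α`: if `α` and `α ∪ {v}` are free faces of dimensions `i`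
and `i + 1`, and `v` appears in position `r` of `α ∪ {v}`, then add the pairing
`α ↗ α ∪ {v}` and remove both faces from the free ones. -/
def instruction (i r : ℕ) (v : V) (S : State V) (α : Finset V) : State V :=
  if α ∈ S.free i ∧ insert v α ∈ S.free (i + 1) ∧ position v (insert v α) = r then
    ⟨insert (α, insert v α) S.pairs,
      fun j => if j = i then (S.free i).erase α
        else if j = i + 1 then (S.free (i + 1)).erase (insert v α)
        else S.free j⟩
  else S

/-- Run the instructions for `i`, `r`, `v` over the `i`-faces in lexicographic order. -/
def processV (F : Finset (Finset V)) (i r : ℕ) (S : State V) (v : V) : State V :=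
  (lexFaces F i).foldl (instruction i r v) S

/-- Run over the vertices, from the largest to the smallest. -/
def processR (F : Finset (Finset V)) (i : ℕ) (S : State V) (r : ℕ) : State V :=
  (verticesDesc F).foldl (processV F i r) S

/-- Run over the positions `r = i + 1, i, …, 0`, provided that there are free faces in both
dimensions `i` and `i + 1`. -/
def processI (F : Finset (Finset V)) (S : State V) (i : ℕ) : State V :=
  if (S.free i).Nonempty ∧ (S.free (i + 1)).Nonempty then
    (List.range (i + 2)).reverse.foldl (processR F i) S
  else S

/-- The dimension of the complex with faces `F`. -/
def dimension (F : Finset (Finset V)) : ℕ := F.sup (fun σ => σ.card - 1)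

/-- Run over the dimensions `i = d - 1, …, 1, 0`, where `d` is the dimension of the complex. -/
def runAlgorithm (F : Finset (Finset V)) : State V :=
  (List.range (dimension F)).reverse.foldl (processI F) (initialState F)

/-- The matching `W` constructed by the algorithm on a finite simplicial complex `K` with linearly
ordered vertices; `(α, β) ∈ W` is the pairing `α ↗ β`. -/
noncomputable def gradientField (K : PreAbstractSimplicialComplex V) [Finite K.faces] :
    Finset (Finset V × Finset V) :=
  (runAlgorithm (Set.toFinite K.faces).toFinset).pairs

/-- A face of `K` is critical for `W` if it is neither redundant nor collapsible. -/
def IsCritical (K : PreAbstractSimplicialComplex V) (W : Finset (Finset V × Finset V))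
    (σ : Finset V) : Prop :=
  σ ∈ K.faces ∧ (∀ β, (σ, β) ∉ W) ∧ (∀ α, (α, σ) ∉ W)

open Classical in
/-- The critical faces of dimension `p` of the algorithmic matching of `K`. -/
noncomputable def criticalFaces (K : PreAbstractSimplicialComplex V) [Finite K.faces] (p : ℕ) :
    Finset (Finset V) :=
  (facesOfDim (Set.toFinite K.faces).toFinset p).filter (IsCritical K (gradientField K))

end Algorithm

/-- `σ` is the simplex of `C_m` with the given columns, listed in their order in the simplex:
each column is, componentwise, at most the next one and different from it. -/
def IsArray (m : ℕ) (columns : List (ℕ × ℕ)) (σ : Finset (ℕ ×ₗ ℕ)) : Prop :=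
  columns.Pairwise (· < ·) ∧ σ = (columns.map toLex).toFinset ∧ σ ∈ (C m).faces

end MunkresModel

/-!
The algorithm is a greedy one: it runs through the candidates `α ↗ α ∪ {v}` in a fixed order and
accepts one if neither face has been used before. A set `M` of candidates is therefore its outcome
as soon as `M` is a matching and every candidate outside `M` shares a face with an earlier member
of `M` (`IsGreedy.mem_pairs_iff`). Of the order only the dimension, the position of `v` and `v`
itself matter, since two candidates that agree in these and share a face are equal.

For `C m` a simplex is the list of its columns, a chain of at most three. A triangle is of one of
two kinds, `(a, b), (a, d), (c, d)` and `(a, b), (c, b), (c, d)`, according to the corner of the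
rectangle it passes through. Since the algorithm tries the last position and the largest column
first, an edge inside a row or column of the grid takes the largest column that extends it at the
end, and afterwards an oblique edge takes the larger of its two corners that is left. In the
lowest dimension, almost every vertex takes `(m, m - 1)` or `(m - 1, m)`. This gives the blocking
pairing for every candidate that is not listed (`settled_edge`, `settled_upper`, `settled_lower`).
That the listed pairings form a matching is a comparison of the entries (`Step.eq_of_left_eq`,
`Step.eq_of_right_eq`, `Step.left_ne_right`), and so is the list of critical faces.

For the numbers, the critical edges through `(m - 1, m)` correspond to the ordered pairs of
distinct numbers in `{1, …, m - 1}` except `(m - 1, m - 2)`, the others to the ordered pairs of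
distinct numbers in `{1, …, m - 2}`; a critical triangle amounts to the two disjoint pairs of
entries in its rows.
-/

namespace MunkresModel

/-! ### Greedy matchings -/

section Greedy

theorem mem_facesOfDim {V : Type*} {F : Finset (Finset V)} {i : ℕ} {σ : Finset V} :
    σ ∈ facesOfDim F i ↔ σ ∈ F ∧ σ.card = i + 1 := by
  simp [facesOfDim]

variable {V : Type*} [LinearOrder V]

/-- Induction along a fold over a strictly decreasing list: before the step at `x`, the entries
dealt with are those greater than `x`. -/
theorem foldl_of_pairwise_gt {ι σ : Type*} [LinearOrder ι] (f : σ → ι → σ)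
    (P : (ι → Prop) → σ → Prop) (l : List ι) (hl : l.Pairwise (· > ·))
    (step : ∀ x ∈ l, ∀ s, P (fun y => y ∈ l ∧ x < y) s → P (fun y => y ∈ l ∧ x ≤ y) (f s x))
    (s : σ) (h0 : P (fun _ => False) s) : P (· ∈ l) (l.foldl f s) := by
  suffices H : ∀ (post pre : List ι), l = pre ++ post → ∀ s, P (· ∈ pre) s →
      P (· ∈ l) (post.foldl f s) from H l [] rfl s (by simpa using h0)
  intro post
  induction post with
  | nil =>
    intro pre h s hs
    simp only [List.append_nil] at h
    simpa [h] using hs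
  | cons x post ih =>
    intro pre h s hs
    refine ih (pre ++ [x]) (by simp [h]) (f s x) ?_
    have hp := hl
    rw [h, List.pairwise_append, List.pairwise_cons] at hp
    obtain ⟨-, ⟨hx, -⟩, hpre⟩ := hp
    have e1 : (fun y => y ∈ l ∧ x < y) = (· ∈ pre) := by
      funext y
      simp only [h, List.mem_append, List.mem_cons, eq_iff_iff]
      constructor
      · rintro ⟨h1 | rfl | h1, h2⟩
        · exact h1
        · exact absurd h2 (lt_irrefl _)
        · exact absurd h2 (hx y h1).not_gt
      · exact fun h1 => ⟨Or.inl h1, hpre y h1 x (by simp)⟩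
    have e2 : (fun y => y ∈ l ∧ x ≤ y) = (· ∈ pre ++ [x]) := by
      funext y
      simp only [h, List.mem_append, List.mem_cons, List.not_mem_nil, or_false, eq_iff_iff]
      constructor
      · rintro ⟨h1 | rfl | h1, h2⟩
        · exact Or.inl h1
        · exact Or.inr rfl
        · exact absurd h2 (hx y h1).not_ge
      · rintro (h1 | rfl)
        · exact ⟨Or.inl h1, (hpre y h1 x (by simp)).le⟩
        · simp
    rw [← e2]
    exact step x (by simp [h]) s (by rwa [e1])

/-- `σ` is one of the two faces `α`, `α ∪ {v}` of a pairing `α ↗ α ∪ {v}`. -/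
def IsEnd (σ α : Finset V) (v : V) : Prop := σ = α ∨ σ = insert v α

/-- The algorithm treats the candidate `α' ↗ α' ∪ {v'}` in an earlier round than
`α ↗ α ∪ {v}`, a round being given by the dimension, the position and the new vertex. The
lexicographic order of the faces inside a round is left out: two candidates of the same round that
share a face are equal. -/
def Earlier (α' : Finset V) (v' : V) (α : Finset V) (v : V) : Prop :=
  α.card < α'.card ∨ α'.card = α.card ∧
    (position v (insert v α) < position v' (insert v' α') ∨
      position v' (insert v' α') = position v (insert v α) ∧ v < v')

/-- A set `M` of pairings `α ↗ α ∪ {v}`, encoded as a relation between `α` and `v`, which is a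
matching on the faces `F` and such that every candidate outside `M` shares a face with an earlier
member of `M`. -/
structure IsGreedy (F : Finset (Finset V)) (M : Finset V → V → Prop) : Prop where
  left_mem : ∀ {α v}, M α v → α ∈ F
  right_mem : ∀ {α v}, M α v → insert v α ∈ F
  notMem : ∀ {α v}, M α v → v ∉ α
  eq_of_isEnd : ∀ {α v α' v' σ}, M α v → M α' v' → IsEnd σ α v → IsEnd σ α' v' → α = α' ∧ v = v'
  blocked : ∀ {α v}, α ∈ F → v ∉ α → insert v α ∈ F → ¬ M α v →
    ∃ α' v' σ, M α' v' ∧ Earlier α' v' α v ∧ IsEnd σ α v ∧ IsEnd σ α' v'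

/-- In the state `S` the pairings made are the members of `M` that satisfy `T`, and the free faces
are those which these leave over. -/
def Realizes (F : Finset (Finset V)) (M T : Finset V → V → Prop) (S : State V) : Prop :=
  (∀ p, p ∈ S.pairs ↔ ∃ α v, M α v ∧ T α v ∧ p = (α, insert v α)) ∧
  ∀ j σ, σ ∈ S.free j ↔ σ ∈ facesOfDim F j ∧ ∀ α v, M α v → T α v → ¬ IsEnd σ α v

theorem Realizes.congr {F : Finset (Finset V)} {M T T' : Finset V → V → Prop} {S : State V}
    (h : Realizes F M T S) (hT : ∀ α v, M α v → (T α v ↔ T' α v)) : Realizes F M T' S := by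
  refine ⟨fun p => (h.1 p).trans ?_, fun j σ => (h.2 j σ).trans (and_congr_right fun _ => ?_)⟩
  · exact exists_congr fun α => exists_congr fun v => and_congr_right fun hM =>
      and_congr_left fun _ => hT α v hM
  · exact forall_congr' fun α => forall_congr' fun v => forall_congr' fun hM => by rw [hT α v hM]

theorem mem_lexFaces {F : Finset (Finset V)} {i : ℕ} {σ : Finset V} :
    σ ∈ lexFaces F i ↔ σ ∈ facesOfDim F i := by
  simp only [lexFaces, List.mem_map, Finset.mem_sort, Finset.mem_image]
  constructor
  · rintro ⟨_, ⟨τ, hτ, rfl⟩, rfl⟩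
    simpa using hτ
  · exact fun h => ⟨_, ⟨σ, h, rfl⟩, by simp⟩

theorem position_insert_le (v : V) (α : Finset V) : position v (insert v α) ≤ α.card := by
  refine Finset.card_le_card fun x hx => ?_
  simp only [Finset.mem_filter, Finset.mem_insert] at hx
  exact hx.1.resolve_left hx.2.ne

variable {F : Finset (Finset V)} {M : Finset V → V → Prop}

/-- One instruction makes its pairing exactly if this belongs to `M`: otherwise an earlier member
of `M` has already used up one of the two faces. -/
theorem IsGreedy.instruction (hM : IsGreedy F M) {T : Finset V → V → Prop} {S : State V}
    {i r : ℕ} {v : V} {α : Finset V} (h : Realizes F M T S) (hα : α ∈ facesOfDim F i)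
    (hT : position v (insert v α) = r → ∀ α' v', M α' v' → Earlier α' v' α v → T α' v') :
    Realizes F M (fun α' v' => T α' v' ∨ α' = α ∧ v' = v ∧ position v (insert v α) = r)
      (instruction i r v S α) := by
  unfold MunkresModel.instruction
  have hαF := mem_facesOfDim.mp hα
  split_ifs with hc
  · obtain ⟨h1, h2, h3⟩ := hc
    obtain ⟨-, h1'⟩ := (h.2 _ _).mp h1
    obtain ⟨h2F, h2'⟩ := (h.2 _ _).mp h2
    rw [mem_facesOfDim] at h2F
    have hv : v ∉ α := fun hv => by
      rw [Finset.insert_eq_of_mem hv] at h2F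
      omega
    have hMv : M α v := by
      by_contra hMv
      obtain ⟨α', v', σ, hM', hE, hσ, hσ'⟩ := hM.blocked hαF.1 hv h2F.1 hMv
      have hT' := hT h3 α' v' hM' hE
      rcases hσ with rfl | rfl
      · exact h1' α' v' hM' hT' hσ'
      · exact h2' α' v' hM' hT' hσ'
    refine ⟨fun p => ?_, fun j σ => ?_⟩
    · simp only [Finset.mem_insert, h.1]
      constructor
      · rintro (rfl | ⟨α', v', h4, h5, rfl⟩)
        · exact ⟨α, v, hMv, Or.inr ⟨rfl, rfl, h3⟩, rfl⟩
        · exact ⟨α', v', h4, Or.inl h5, rfl⟩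
      · rintro ⟨α', v', h4, h5 | ⟨rfl, rfl, -⟩, rfl⟩
        · exact Or.inr ⟨α', v', h4, h5, rfl⟩
        · exact Or.inl rfl
    · have key : σ ∈ (if j = i then (S.free i).erase α
          else if j = i + 1 then (S.free (i + 1)).erase (insert v α) else S.free j) ↔
          σ ∈ S.free j ∧ ¬ IsEnd σ α v := by
        have hd : σ ∈ S.free j → σ.card = j + 1 := fun hσ =>
          (mem_facesOfDim.mp ((h.2 _ _).mp hσ).1).2
        unfold IsEnd
        by_cases hj : j = i
        · subst hj
          simp only [if_true, Finset.mem_erase]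
          constructor
          · rintro ⟨h4, h5⟩
            refine ⟨h5, ?_⟩
            rintro (rfl | rfl)
            · exact h4 rfl
            · have := hd h5
              omega
          · exact fun ⟨h4, h5⟩ => ⟨fun h6 => h5 (Or.inl h6), h4⟩
        by_cases hj' : j = i + 1
        · subst hj'
          simp only [hj, if_true, if_false, Finset.mem_erase]
          constructor
          · rintro ⟨h4, h5⟩
            refine ⟨h5, ?_⟩
            rintro (rfl | rfl)
            · have := hd h5
              omega
            · exact h4 rfl
          · exact fun ⟨h4, h5⟩ => ⟨fun h6 => h5 (Or.inr h6), h4⟩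
        · simp only [hj, hj', if_false]
          refine ⟨fun h4 => ⟨h4, ?_⟩, fun h4 => h4.1⟩
          have := hd h4
          rintro (rfl | rfl) <;> omega
      rw [key, h.2]
      constructor
      · rintro ⟨⟨h4, h5⟩, h6⟩
        refine ⟨h4, ?_⟩
        rintro α' v' h7 (h8 | ⟨rfl, rfl, -⟩)
        · exact h5 α' v' h7 h8
        · exact h6
      · rintro ⟨h4, h5⟩
        exact ⟨⟨h4, fun α' v' h6 h7 => h5 α' v' h6 (Or.inl h7)⟩,
          h5 α v hMv (Or.inr ⟨rfl, rfl, h3⟩)⟩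
  · refine h.congr fun α' v' hM' => ⟨Or.inl, ?_⟩
    rintro (h4 | ⟨rfl, rfl, h4⟩)
    · exact h4
    · by_contra hTn
      have hfree : ∀ σ, IsEnd σ α' v' → ∀ α v, M α v → T α v → ¬ IsEnd σ α v := by
        intro σ hσ α v h5 h6 h7
        obtain ⟨rfl, rfl⟩ := hM.eq_of_isEnd hM' h5 hσ h7
        exact hTn h6
      refine hc ⟨(h.2 _ _).mpr ⟨hα, hfree _ (Or.inl rfl)⟩,
        (h.2 _ _).mpr ⟨mem_facesOfDim.mpr ⟨hM.right_mem hM', ?_⟩, hfree _ (Or.inr rfl)⟩, h4⟩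
      rw [Finset.card_insert_of_notMem (hM.notMem hM'), hαF.2]

/-- A run over the faces completes the round of `v`: the pairings made before are those of larger
dimension, of larger position, or of the same position and a larger new vertex. -/
theorem IsGreedy.processV (hM : IsGreedy F M) {S : State V} {i r : ℕ} {v : V}
    (h : Realizes F M (fun α' v' => i + 1 < α'.card ∨ α'.card = i + 1 ∧
      (r < position v' (insert v' α') ∨ position v' (insert v' α') = r ∧ v < v')) S) :
    Realizes F M (fun α' v' => i + 1 < α'.card ∨ α'.card = i + 1 ∧
      (r < position v' (insert v' α') ∨ position v' (insert v' α') = r ∧ v ≤ v'))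
      (processV F i r S v) := by
  unfold MunkresModel.processV
  suffices H : ∀ (l : List (Finset V)) (T : Finset V → V → Prop) (S : State V),
      (∀ α ∈ l, α ∈ facesOfDim F i) →
      (∀ α' v', (i + 1 < α'.card ∨ α'.card = i + 1 ∧
        (r < position v' (insert v' α') ∨ position v' (insert v' α') = r ∧ v < v')) → T α' v') →
      Realizes F M T S →
      Realizes F M (fun α' v' => T α' v' ∨ α' ∈ l ∧ v' = v ∧ position v (insert v α') = r)
        (l.foldl (MunkresModel.instruction i r v) S) by
    refine (H _ _ S (fun α hα => mem_lexFaces.mp hα) (fun _ _ h => h) h).congr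
      fun α' v' hM' => ?_
    have hl : α' ∈ lexFaces F i ↔ α'.card = i + 1 := by
      rw [mem_lexFaces, mem_facesOfDim]
      exact and_iff_right (hM.left_mem hM')
    rw [hl, le_iff_lt_or_eq]
    constructor
    · rintro ((h1 | ⟨h1, h2 | ⟨h2, h3⟩⟩) | ⟨h1, rfl, h2⟩)
      · exact Or.inl h1
      · exact Or.inr ⟨h1, Or.inl h2⟩
      · exact Or.inr ⟨h1, Or.inr ⟨h2, Or.inl h3⟩⟩
      · exact Or.inr ⟨h1, Or.inr ⟨h2, Or.inr rfl⟩⟩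
    · rintro (h1 | ⟨h1, h2 | ⟨h2, h3 | rfl⟩⟩)
      · exact Or.inl (Or.inl h1)
      · exact Or.inl (Or.inr ⟨h1, Or.inl h2⟩)
      · exact Or.inl (Or.inr ⟨h1, Or.inr ⟨h2, h3⟩⟩)
      · exact Or.inr ⟨h1, rfl, h2⟩
  intro l
  induction l with
  | nil => exact fun T S _ _ h => h.congr fun α' v' _ => by simp
  | cons α l ih =>
    intro T S hl hT h
    have hα := hl α (by simp)
    rw [List.foldl_cons]
    refine (ih _ _ (fun α' h' => hl α' (by simp [h'])) (fun α' v' h' => Or.inl (hT α' v' h'))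
      (hM.instruction h hα ?_)).congr fun α' v' _ => ?_
    · rintro hr α' v' - hE
      refine hT α' v' ?_
      unfold Earlier at hE
      rwa [hr, (mem_facesOfDim.mp hα).2] at hE
    · simp only [List.mem_cons]
      constructor
      · rintro ((h1 | ⟨rfl, h1⟩) | ⟨h1, h2⟩)
        · exact Or.inl h1
        · exact Or.inr ⟨Or.inl rfl, h1⟩
        · exact Or.inr ⟨Or.inr h1, h2⟩
      · rintro (h1 | ⟨rfl | h1, h2⟩)
        · exact Or.inl (Or.inl h1)
        · exact Or.inl (Or.inr ⟨rfl, h2⟩)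
        · exact Or.inr ⟨h1, h2⟩

theorem IsGreedy.processR (hM : IsGreedy F M) {S : State V} {i r : ℕ}
    (h : Realizes F M (fun α' v' => i + 1 < α'.card ∨ α'.card = i + 1 ∧
      r < position v' (insert v' α')) S) :
    Realizes F M (fun α' v' => i + 1 < α'.card ∨ α'.card = i + 1 ∧
      r ≤ position v' (insert v' α')) (processR F i S r) := by
  have hv : ∀ α' v', M α' v' → v' ∈ verticesDesc F := fun α' v' hM' => by
    simp only [verticesDesc, Finset.mem_sort, Finset.mem_biUnion, id]
    exact ⟨_, hM.right_mem hM', Finset.mem_insert_self _ _⟩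
  refine (foldl_of_pairwise_gt (MunkresModel.processV F i r)
    (fun X => Realizes F M (fun α' v' => i + 1 < α'.card ∨ α'.card = i + 1 ∧
      (r < position v' (insert v' α') ∨ position v' (insert v' α') = r ∧ X v')))
    (verticesDesc F) ?_ ?_ S ?_).congr ?_
  · exact (Finset.sortedGT_sort _).pairwise
  · intro v _ S hS
    refine (hM.processV (v := v) (hS.congr ?_)).congr ?_
    · intro α' v' hM'
      simp [hv α' v' hM']
    · intro α' v' hM'
      simp [hv α' v' hM']
  · exact h.congr fun α' v' _ => by simp
  · intro α' v' hM'
    simp only [hv α' v' hM', and_true, le_iff_lt_or_eq, eq_comm]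

theorem IsGreedy.processI (hM : IsGreedy F M) {S : State V} {i : ℕ}
    (h : Realizes F M (fun α' _ => i + 1 < α'.card) S) :
    Realizes F M (fun α' _ => i + 1 ≤ α'.card) (processI F S i) := by
  unfold MunkresModel.processI
  split_ifs with hc
  · refine (foldl_of_pairwise_gt (MunkresModel.processR F i)
      (fun X => Realizes F M (fun α' v' => i + 1 < α'.card ∨ α'.card = i + 1 ∧
        X (position v' (insert v' α'))))
      (List.range (i + 2)).reverse ?_ ?_ S ?_).congr ?_
    · exact List.pairwise_reverse.mpr List.pairwise_lt_range
    · intro r _ S hS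
      refine (hM.processR (r := r) (hS.congr ?_)).congr ?_
      all_goals
        intro α' v' hM'
        have := position_insert_le v' α'
        simp only [List.mem_reverse, List.mem_range]
        omega
    · exact h.congr fun α' v' _ => by simp
    · intro α' v' hM'
      have := position_insert_le v' α'
      simp only [List.mem_reverse, List.mem_range]
      omega
  · refine h.congr fun α' v' hM' => ⟨fun h' => h'.le, fun h' => ?_⟩
    -- a member of `M` in dimension `i` would still be free, and the step not be skipped
    by_contra hn
    have hcard : α'.card = i + 1 := by omega
    have hfree : ∀ σ, IsEnd σ α' v' → ∀ α v, M α v → i + 1 < α.card → ¬ IsEnd σ α v := by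
      intro σ hσ α v h5 h6 h7
      obtain ⟨rfl, rfl⟩ := hM.eq_of_isEnd hM' h5 hσ h7
      omega
    refine hc ⟨⟨α', (h.2 _ _).mpr ⟨mem_facesOfDim.mpr ⟨hM.left_mem hM', hcard⟩,
      hfree _ (Or.inl rfl)⟩⟩, ⟨insert v' α', (h.2 _ _).mpr
      ⟨mem_facesOfDim.mpr ⟨hM.right_mem hM', ?_⟩, hfree _ (Or.inr rfl)⟩⟩⟩
    rw [Finset.card_insert_of_notMem (hM.notMem hM'), hcard]

/-- The algorithm constructs the only set of pairings that is greedy for its order. -/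
theorem IsGreedy.mem_pairs_iff (hM : IsGreedy F M) (hF : ∅ ∉ F) (p : Finset V × Finset V) :
    p ∈ (runAlgorithm F).pairs ↔ ∃ α v, M α v ∧ p = (α, insert v α) := by
  have hcard : ∀ α v, M α v → α.card - 1 < dimension F ∧ 0 < α.card := fun α v hαv => by
    have h1 : 0 < α.card := Finset.card_pos.mpr (Finset.nonempty_iff_ne_empty.mpr fun h =>
      hF (h ▸ hM.left_mem hαv))
    have h2 : (insert v α).card - 1 ≤ dimension F :=
      Finset.le_sup (f := fun σ : Finset V => σ.card - 1) (hM.right_mem hαv)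
    rw [Finset.card_insert_of_notMem (hM.notMem hαv)] at h2
    omega
  have key : Realizes F M (fun _ _ => True) (runAlgorithm F) := by
    refine (foldl_of_pairwise_gt (MunkresModel.processI F)
      (fun X => Realizes F M (fun α' _ => X (α'.card - 1)))
      (List.range (dimension F)).reverse ?_ ?_ (initialState F) ?_).congr ?_
    · exact List.pairwise_reverse.mpr List.pairwise_lt_range
    · intro i _ S hS
      refine (hM.processI (i := i) (hS.congr ?_)).congr ?_
      all_goals
        intro α' v' hM'
        have := hcard α' v' hM'
        simp only [List.mem_reverse, List.mem_range]
        omega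
    · exact ⟨by simp [initialState], by simp [initialState]⟩
    · intro α' v' hM'
      simpa using (hcard α' v' hM').1
  simpa using key.1 p

end Greedy

/-! ### The simplices of `C m` as lists of columns -/

/-- The set of columns of a matrix that is given by the list of its columns. -/
def columnSet (l : List (ℕ × ℕ)) : Finset (ℕ ×ₗ ℕ) := (l.map toLex).toFinset

/-- The condition, on the entries alone, that the columns in `l` form a simplex of `C m` and are
listed in increasing order. That a row takes at most two values is expressed by any three of its
entries having a repetition. -/
def IsMatrix (m : ℕ) (l : List (ℕ × ℕ)) : Prop :=
  l ≠ [] ∧ l.Pairwise (· < ·) ∧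
    (∀ p ∈ l, 1 ≤ p.1 ∧ p.1 ≤ m ∧ 1 ≤ p.2 ∧ p.2 ≤ m ∧ p.1 ≠ p.2) ∧
    ∀ p ∈ l, ∀ q ∈ l, ∀ r ∈ l, (p.1 = q.1 ∨ q.1 = r.1 ∨ p.1 = r.1) ∧
      (p.2 = q.2 ∨ q.2 = r.2 ∨ p.2 = r.2)

theorem mem_columnSet {l : List (ℕ × ℕ)} {p : ℕ ×ₗ ℕ} : p ∈ columnSet l ↔ ofLex p ∈ l := by
  simp only [columnSet, List.mem_toFinset, List.mem_map]
  exact ⟨fun ⟨q, hq, h⟩ => h ▸ hq, fun h => ⟨_, h, rfl⟩⟩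

theorem columnSet_eq_image (l : List (ℕ × ℕ)) : columnSet l = l.toFinset.image toLex := by
  ext p
  simp only [mem_columnSet, Finset.mem_image, List.mem_toFinset]
  exact ⟨fun h => ⟨_, h, rfl⟩, fun ⟨q, hq, h⟩ => h ▸ hq⟩

theorem insert_columnSet (pre post : List (ℕ × ℕ)) (v : ℕ × ℕ) :
    insert (toLex v) (columnSet (pre ++ post)) = columnSet (pre ++ v :: post) := by
  ext p
  simp only [Finset.mem_insert, mem_columnSet, List.mem_append, List.mem_cons]
  have : p = toLex v ↔ ofLex p = v := Iff.rfl
  rw [this]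
  tauto

theorem notMem_columnSet {pre post : List (ℕ × ℕ)} {v : ℕ × ℕ}
    (h : (pre ++ v :: post).Pairwise (· < ·)) : toLex v ∉ columnSet (pre ++ post) := by
  have hnd : (pre ++ v :: post).Nodup := h.imp ne_of_lt
  rw [mem_columnSet]
  exact (List.nodup_middle.mp hnd).notMem

theorem columnSet_injOn {l l' : List (ℕ × ℕ)} (hl : l.Pairwise (· < ·))
    (hl' : l'.Pairwise (· < ·)) (h : columnSet l = columnSet l') : l = l' := by
  refine hl.eq_of_mem_iff hl' fun p => ?_
  have := Finset.ext_iff.mp h (toLex p)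
  simpa [mem_columnSet] using this

theorem card_columnSet {l : List (ℕ × ℕ)} (hl : l.Pairwise (· < ·)) :
    (columnSet l).card = l.length := by
  rw [columnSet_eq_image, Finset.card_image_of_injective _ toLex.injective]
  exact List.toFinset_card_of_nodup (hl.imp ne_of_lt)

theorem position_columnSet {pre post : List (ℕ × ℕ)} {v : ℕ × ℕ}
    (h : (pre ++ v :: post).Pairwise (· < ·)) :
    position (toLex v) (columnSet (pre ++ v :: post)) = pre.length := by
  rw [List.pairwise_append, List.pairwise_cons] at h
  obtain ⟨h1, ⟨h2, -⟩, h3⟩ := h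
  rw [← card_columnSet h1]
  unfold position
  congr 1
  ext p
  simp only [Finset.mem_filter, mem_columnSet, List.mem_append, List.mem_cons]
  constructor
  · rintro ⟨h4 | h4 | h4, h5⟩
    · exact h4
    · exact absurd h5 (h4 ▸ lt_irrefl _)
    · exact absurd h5 (Prod.Lex.toLex_strictMono (h2 _ h4)).not_gt
  · exact fun h4 => ⟨Or.inl h4, Prod.Lex.toLex_strictMono (h3 _ h4 v (by simp))⟩

theorem card_le_two_iff {ι : Type*} [DecidableEq ι] (s : Finset ι) :
    s.card ≤ 2 ↔ ∀ a ∈ s, ∀ b ∈ s, ∀ c ∈ s, a = b ∨ b = c ∨ a = c := by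
  rw [← not_lt, Finset.two_lt_card]
  push Not
  refine ⟨fun h a ha b hb c hc => ?_, fun h a ha b hb c hc hab hac => ?_⟩
  · by_contra! hn
    exact hn.2.1 (h a ha b hb c hc hn.1 hn.2.2)
  · exact ((h a ha b hb c hc).resolve_left hab).resolve_right hac

theorem mem_confModel_completeGraphComplex {m : ℕ} {τ : Finset (ℕ × ℕ)} :
    τ ∈ (confModel (completeGraphComplex m)).faces ↔
      τ.Nonempty ∧ IsChain (· ≤ ·) (τ : Set (ℕ × ℕ)) ∧
      (∀ p ∈ τ, 1 ≤ p.1 ∧ p.1 ≤ m ∧ 1 ≤ p.2 ∧ p.2 ≤ m ∧ p.1 ≠ p.2) ∧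
      ∀ p ∈ τ, ∀ q ∈ τ, ∀ r ∈ τ, (p.1 = q.1 ∨ q.1 = r.1 ∨ p.1 = r.1) ∧
        (p.2 = q.2 ∨ q.2 = r.2 ∨ p.2 = r.2) := by
  have hK : ∀ s : Finset ℕ, s ∈ (completeGraphComplex m).faces ↔
      s.Nonempty ∧ s ⊆ Finset.Icc 1 m ∧ s.card ≤ 2 := fun _ => Iff.rfl
  have hX : ∀ τ : Finset (ℕ × ℕ), τ ∈ (orderedProduct (completeGraphComplex m)
      (completeGraphComplex m)).faces ↔ τ.Nonempty ∧ IsChain (· ≤ ·) (τ : Set (ℕ × ℕ)) ∧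
      τ.image Prod.fst ∈ (completeGraphComplex m).faces ∧
      τ.image Prod.snd ∈ (completeGraphComplex m).faces := fun _ => Iff.rfl
  have hC : τ ∈ (confModel (completeGraphComplex m)).faces ↔
      τ ∈ (orderedProduct (completeGraphComplex m) (completeGraphComplex m)).faces ∧
      ∀ ρ, (ρ ∈ (orderedProduct (completeGraphComplex m) (completeGraphComplex m)).faces ∧
        ∀ p ∈ ρ, p.1 = p.2) → Disjoint τ ρ := Iff.rfl
  rw [hC, hX]
  simp only [hK, Finset.image_nonempty, card_le_two_iff, Finset.forall_mem_image,
    Finset.subset_iff, Finset.mem_Icc]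
  constructor
  · rintro ⟨⟨h0, h1, ⟨-, h2, h3⟩, -, h4, h5⟩, h6⟩
    refine ⟨h0, h1, fun p hp => ⟨(h2 hp).1, (h2 hp).2, (h4 hp).1, (h4 hp).2, fun hpp => ?_⟩,
      fun p hp q hq r hr => ⟨h3 hp hq hr, h5 hp hq hr⟩⟩
    -- a column with equal entries is a vertex of the diagonal
    refine Finset.disjoint_left.mp (h6 {p} ⟨(hX _).mpr ⟨by simp, by simp, ?_, ?_⟩, ?_⟩) hp (by simp)
    · simpa [hK] using h2 hp
    · simpa [hK] using h4 hp
    · simpa using hpp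
  · rintro ⟨h0, h1, h2, h3⟩
    refine ⟨⟨h0, h1, ⟨h0, fun p hp => ⟨(h2 p hp).1, (h2 p hp).2.1⟩,
      fun p hp q hq r hr => (h3 p hp q hq r hr).1⟩, h0,
      fun p hp => ⟨(h2 p hp).2.2.1, (h2 p hp).2.2.2.1⟩,
      fun p hp q hq r hr => (h3 p hp q hq r hr).2⟩, ?_⟩
    rintro ρ ⟨-, hρ⟩
    exact Finset.disjoint_left.mpr fun p hp hp' => (h2 p hp).2.2.2.2 (hρ p hp')

theorem columnSet_mem_C {m : ℕ} {l : List (ℕ × ℕ)} :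
    columnSet l ∈ (C m).faces ↔ l.toFinset ∈ (confModel (completeGraphComplex m)).faces := by
  rw [columnSet_eq_image]
  exact (Finset.image_injective toLex.injective).mem_set_image

theorem isArray_iff {m : ℕ} {l : List (ℕ × ℕ)} {σ : Finset (ℕ ×ₗ ℕ)} :
    IsArray m l σ ↔ IsMatrix m l ∧ σ = columnSet l := by
  have key : l.Pairwise (· < ·) → (columnSet l ∈ (C m).faces ↔ IsMatrix m l) := fun hl => by
    rw [columnSet_mem_C, mem_confModel_completeGraphComplex]
    have hchain : IsChain (· ≤ ·) (l.toFinset : Set (ℕ × ℕ)) := by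
      intro p hp q hq hpq
      simp only [List.coe_toFinset, Set.mem_ofPred_eq] at hp hq
      have h2 : l.Pairwise (fun p q => p ≤ q ∨ q ≤ p) := hl.imp fun h => Or.inl h.le
      have : Std.Symm (fun p q : ℕ × ℕ => p ≤ q ∨ q ≤ p) := ⟨fun _ _ => Or.symm⟩
      exact h2.forall_of_forall (R := fun p q : ℕ × ℕ => p ≤ q ∨ q ≤ p)
        (fun _ _ => Or.inl le_rfl) hp hq
    simp only [IsMatrix, hl, hchain, List.mem_toFinset, true_and, List.toFinset_nonempty_iff]
  constructor
  · rintro ⟨h1, rfl, h2⟩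
    exact ⟨(key h1).mp h2, rfl⟩
  · rintro ⟨h1, rfl⟩
    exact ⟨h1.2.1, rfl, (key h1.2.1).mpr h1⟩

theorem IsMatrix.columnSet_mem {m : ℕ} {l : List (ℕ × ℕ)} (h : IsMatrix m l) :
    columnSet l ∈ (C m).faces :=
  (isArray_iff.mpr ⟨h, rfl⟩).2.2

theorem exists_isMatrix {m : ℕ} {σ : Finset (ℕ ×ₗ ℕ)} (hσ : σ ∈ (C m).faces) :
    ∃ l, IsMatrix m l ∧ σ = columnSet l := by
  obtain ⟨τ, hτ, rfl⟩ := hσ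
  have hmem : ∀ p, p ∈ ((τ.image toLex).sort (· ≤ ·)).map ofLex ↔ p ∈ τ := fun p => by
    simp only [List.mem_map, Finset.mem_sort, Finset.mem_image]
    exact ⟨fun ⟨_, ⟨q, hq, h1⟩, h2⟩ => h2 ▸ h1 ▸ hq, fun h => ⟨_, ⟨p, h, rfl⟩, rfl⟩⟩
  have hset : columnSet (((τ.image toLex).sort (· ≤ ·)).map ofLex) = τ.image toLex := by
    rw [columnSet_eq_image]
    congr 1
    ext p
    rw [List.mem_toFinset, hmem]
  refine ⟨((τ.image toLex).sort (· ≤ ·)).map ofLex, (isArray_iff.mp ⟨?_, hset.symm, τ, hτ, rfl⟩).1,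
    hset.symm⟩
  have hchain := (mem_confModel_completeGraphComplex.mp hτ).2.1
  have h1 : (((τ.image toLex).sort (· ≤ ·)).map ofLex).Pairwise (fun p q => toLex p < toLex q) :=
    List.pairwise_map.mpr (by simpa using (Finset.sortedLT_sort (τ.image toLex)).pairwise)
  refine List.Pairwise.imp_of_mem (fun {p q} hp hq hpq => ?_) h1
  rw [hmem] at hp hq
  have hne : p ≠ q := fun h => hpq.ne (congrArg toLex h)
  rcases hchain hp hq hne with h | h
  · exact lt_of_le_of_ne h hne
  · exact absurd hpq (Prod.Lex.toLex_strictMono (lt_of_le_of_ne h hne.symm)).not_gt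

theorem prod_lt_iff {a b c d : ℕ} : (a, b) < (c, d) ↔ a ≤ c ∧ b ≤ d ∧ (a < c ∨ b < d) := by
  rw [Prod.mk_lt_mk]
  omega

theorem toLex_lt_iff {a b c d : ℕ} :
    toLex (a, b) < toLex (c, d) ↔ a < c ∨ a = c ∧ b < d :=
  Prod.Lex.toLex_lt_toLex

theorem isMatrix_one {m a b : ℕ} :
    IsMatrix m [(a, b)] ↔ 1 ≤ a ∧ a ≤ m ∧ 1 ≤ b ∧ b ≤ m ∧ a ≠ b := by
  simp [IsMatrix]

theorem isMatrix_two {m a b c d : ℕ} :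
    IsMatrix m [(a, b), (c, d)] ↔ (a ≤ c ∧ b ≤ d ∧ (a < c ∨ b < d)) ∧
      1 ≤ a ∧ c ≤ m ∧ 1 ≤ b ∧ d ≤ m ∧ a ≠ b ∧ c ≠ d := by
  simp only [IsMatrix, ne_eq, reduceCtorEq, not_false_eq_true, List.pairwise_cons,
    List.mem_cons, List.not_mem_nil, or_false, forall_eq, forall_eq_or_imp, prod_lt_iff,
    true_and, List.Pairwise.nil, and_true]
  simp only [true_or, or_true, and_true, false_imp_iff, implies_true]
  omega

theorem isMatrix_three {m a b x y c d : ℕ} :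
    IsMatrix m [(a, b), (x, y), (c, d)] ↔
      (a ≤ x ∧ b ≤ y ∧ (a < x ∨ b < y)) ∧ (x ≤ c ∧ y ≤ d ∧ (x < c ∨ y < d)) ∧
      1 ≤ a ∧ c ≤ m ∧ 1 ≤ b ∧ d ≤ m ∧ a ≠ b ∧ x ≠ y ∧ c ≠ d ∧ (a = x ∨ x = c) ∧
      (b = y ∨ y = d) := by
  constructor
  · rintro ⟨-, h1, h2, h3⟩
    have h4 := h3 (a, b) (by simp) (x, y) (by simp) (c, d) (by simp)
    simp only [List.pairwise_cons, List.mem_cons, List.not_mem_nil, or_false, forall_eq,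
      forall_eq_or_imp, prod_lt_iff] at h1 h2 h4
    omega
  · intro h
    refine ⟨by simp, ?_, ?_, ?_⟩
    · simp only [List.pairwise_cons, List.mem_cons, List.not_mem_nil, or_false, forall_eq,
        forall_eq_or_imp, prod_lt_iff, false_imp_iff, implies_true, and_true, List.Pairwise.nil]
      omega
    · simp only [List.mem_cons, List.not_mem_nil, or_false, forall_eq, forall_eq_or_imp]
      omega
    · have h2 : ∀ p ∈ [(a, b), (x, y), (c, d)], (p.1 = a ∨ p.1 = c) ∧ (p.2 = b ∨ p.2 = d) := by
        simp only [List.mem_cons, List.not_mem_nil, or_false, forall_eq, forall_eq_or_imp,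
          true_or, or_true, true_and, and_true]
        omega
      intro p hp q hq r hr
      have := h2 p hp
      have := h2 q hq
      have := h2 r hr
      omega

theorem not_isMatrix_cons_four {m : ℕ} {p q r s : ℕ × ℕ} {l : List (ℕ × ℕ)} :
    ¬ IsMatrix m (p :: q :: r :: s :: l) := by
  obtain ⟨a, b⟩ := p
  obtain ⟨x, y⟩ := q
  obtain ⟨c, d⟩ := r
  obtain ⟨z, w⟩ := s
  rintro ⟨-, h1, -, h2⟩
  have h3 := h2 (a, b) (by simp) (x, y) (by simp) (c, d) (by simp)
  have h4 := h2 (x, y) (by simp) (c, d) (by simp) (z, w) (by simp)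
  have h5 := h2 (a, b) (by simp) (x, y) (by simp) (z, w) (by simp)
  simp only [List.pairwise_cons, List.mem_cons, forall_eq_or_imp, prod_lt_iff] at h1
  omega

theorem IsMatrix.subset {m : ℕ} {pre post : List (ℕ × ℕ)} {v : ℕ × ℕ}
    (h : IsMatrix m (pre ++ v :: post)) (hne : pre ++ post ≠ []) : IsMatrix m (pre ++ post) := by
  have hs : (pre ++ post).Sublist (pre ++ v :: post) :=
    (List.Sublist.refl _).append (List.sublist_cons_self _ _)
  have hm : ∀ p ∈ pre ++ post, p ∈ pre ++ v :: post := fun p hp => hs.subset hp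
  exact ⟨hne, h.2.1.sublist hs, fun p hp => h.2.2.1 p (hm p hp), fun p hp q hq r hr =>
    h.2.2.2 p (hm p hp) q (hm q hq) r (hm r hr)⟩

theorem IsMatrix.shape {m : ℕ} {l : List (ℕ × ℕ)} (h : IsMatrix m l) :
    (∃ a b, l = [(a, b)]) ∨ (∃ a b c d, l = [(a, b), (c, d)]) ∨
      (∃ a b c d, l = [(a, b), (a, d), (c, d)]) ∨ ∃ a b c d, l = [(a, b), (c, b), (c, d)] := by
  match l, h with
  | [], h => exact absurd rfl h.1
  | [(a, b)], _ => exact Or.inl ⟨a, b, rfl⟩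
  | [(a, b), (c, d)], _ => exact Or.inr (Or.inl ⟨a, b, c, d, rfl⟩)
  | [(a, b), (x, y), (c, d)], h =>
    rw [isMatrix_three] at h
    have : a = x ∧ y = d ∨ x = c ∧ b = y := by omega
    rcases this with ⟨rfl, rfl⟩ | ⟨rfl, rfl⟩
    · exact Or.inr (Or.inr (Or.inl ⟨_, _, _, _, rfl⟩))
    · exact Or.inr (Or.inr (Or.inr ⟨_, _, _, _, rfl⟩))
  | p :: q :: r :: s :: l, h => exact absurd h not_isMatrix_cons_four

/-! ### The pairings and their priorities -/

/-- The pairings made on `C m`, in the nine families of the theorem: the columns `pre ++ post` of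
the smaller face, the new column `v`, and its place between `pre` and `post`. The conditions that
make `pre ++ v :: post` a simplex are not included. -/
inductive Step (m : ℕ) : List (ℕ × ℕ) → ℕ × ℕ → List (ℕ × ℕ) → Prop
  | a (a b d : ℕ) (ha : a < m) (hd : d < m) : Step m [(a, b), (a, d)] (m, d) []
  | b (a b : ℕ) (ha : a < m - 1) : Step m [(a, b), (a, m)] (m - 1, m) []
  | c (a b c : ℕ) (hb : b < m) (hc : c < m) : Step m [(a, b), (c, b)] (c, m) []
  | d (a b : ℕ) (hb : b < m - 1) : Step m [(a, b), (m, b)] (m, m - 1) []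
  | e (a b c d : ℕ) (hac : a < c) (hbd : b < d) (hbc : b ≠ c)
      (h : (c < m ∧ d < m) ∨ (c = m ∧ d + 1 < m)) : Step m [(a, b)] (c, b) [(c, d)]
  | f (a b c d : ℕ) (hac : a < c) (hbd : b < d) (had : a ≠ d)
      (h : (b = c ∧ c < m ∧ d < m) ∨ (c + 1 < m ∧ d = m)) : Step m [(a, b)] (a, d) [(c, d)]
  | g (a b : ℕ) (h : b < m - 1 ∨ (a < m - 1 ∧ b = m - 1)) : Step m [(a, b)] (m, m - 1) []
  | h (a : ℕ) (ha : a < m - 1) : Step m [(a, m)] (m - 1, m) []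
  | i : Step m [] (m - 1, m - 2) [(m - 1, m)]

theorem Step.append_ne_nil {m : ℕ} {pre post : List (ℕ × ℕ)} {v : ℕ × ℕ}
    (h : Step m pre v post) : pre ++ post ≠ [] := by
  cases h <;> simp

theorem isMatrix_upper {m a b c d : ℕ} :
    IsMatrix m [(a, b), (a, d), (c, d)] ↔
      a < c ∧ b < d ∧ 1 ≤ a ∧ c ≤ m ∧ 1 ≤ b ∧ d ≤ m ∧ a ≠ b ∧ a ≠ d ∧ c ≠ d := by
  simp only [isMatrix_three, true_or, or_true, and_true]
  omega

theorem isMatrix_lower {m a b c d : ℕ} :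
    IsMatrix m [(a, b), (c, b), (c, d)] ↔
      a < c ∧ b < d ∧ 1 ≤ a ∧ c ≤ m ∧ 1 ≤ b ∧ d ≤ m ∧ a ≠ b ∧ b ≠ c ∧ c ≠ d := by
  simp only [isMatrix_three, true_or, or_true, and_true]
  omega

/-- The candidate that inserts the column `v` between `pre` and `post` is one of the listed
pairings, or it shares a face with a listed pairing that the algorithm treats earlier. All such
conflicts are settled within one dimension. -/
def Settled (m : ℕ) (pre : List (ℕ × ℕ)) (v : ℕ × ℕ) (post : List (ℕ × ℕ)) : Prop :=
  Step m pre v post ∨ ∃ pre' v' post', Step m pre' v' post' ∧ IsMatrix m (pre' ++ v' :: post') ∧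
    (pre' ++ post').length = (pre ++ post).length ∧
    (pre.length < pre'.length ∨ pre'.length = pre.length ∧ toLex v < toLex v') ∧
    (pre' ++ post' = pre ++ post ∨ pre' ++ v' :: post' = pre ++ v :: post)

/-- A vertex other than `(m, m - 1)` and `(m - 1, m)` prefers the largest column to its right, which
is `(m, m - 1)`, or `(m - 1, m)` if its second entry is `m`; the vertex `(m - 1, m)` has nothing to
its right and prefers the largest column to its left. -/
theorem settled_edge {m a b c d : ℕ} (hm : 4 ≤ m) (h : IsMatrix m [(a, b), (c, d)]) :
    Settled m [] (a, b) [(c, d)] ∧ Settled m [(a, b)] (c, d) [] := by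
  have h' := isMatrix_two.mp h
  have hp : c = m ∧ d = m - 1 ∨ b = m ∧ c = m - 1 → Step m [(a, b)] (c, d) [] := by
    rintro (⟨rfl, rfl⟩ | ⟨rfl, rfl⟩)
    · exact .g _ _ (by omega)
    · obtain rfl : b = d := by omega
      exact .h _ (by omega)
  -- the pairing of a vertex other than `(m, m - 1)` and `(m - 1, m)`
  have hv : ∀ x y, 1 ≤ x → x ≤ m → 1 ≤ y → y ≤ m → x ≠ y → ¬ (x = m ∧ y = m - 1) →
      ¬ (x = m - 1 ∧ y = m) → ∃ v', Step m [(x, y)] v' [] ∧ IsMatrix m [(x, y), v'] ∧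
        (y < m → v' = (m, m - 1)) ∧ (y = m → v' = (m - 1, m)) := by
    intro x y h1 h2 h3 h4 h5 h6 h7
    rcases h4.lt_or_eq with h8 | rfl
    · exact ⟨(m, m - 1), .g _ _ (by omega), isMatrix_two.mpr (by omega), by simp, by omega⟩
    · exact ⟨(y - 1, y), .h _ (by omega), isMatrix_two.mpr (by omega), by simp, by simp⟩
  constructor
  · by_cases h1 : c = m ∧ d = m - 1 ∨ b = m ∧ c = m - 1
    · exact Or.inr ⟨[(a, b)], (c, d), [], hp h1, h, rfl, Or.inl Nat.zero_lt_one, Or.inr rfl⟩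
    by_cases h2 : c = m - 1 ∧ d = m
    · obtain ⟨rfl, rfl⟩ := h2
      by_cases h3 : a = d - 1 ∧ b = d - 2
      · obtain ⟨rfl, rfl⟩ := h3
        exact Or.inl .i
      · exact Or.inr ⟨[], (d - 1, d - 2), [(d - 1, d)], .i, isMatrix_two.mpr (by omega), rfl,
          Or.inr ⟨rfl, toLex_lt_iff.mpr (by omega)⟩, Or.inl rfl⟩
    · obtain ⟨v', h3, h4, -⟩ := hv c d (by omega) (by omega) (by omega) (by omega) (by omega)
        (by omega) h2
      exact Or.inr ⟨[(c, d)], v', [], h3, h4, rfl, Or.inl Nat.zero_lt_one, Or.inl rfl⟩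
  · by_cases h1 : c = m ∧ d = m - 1 ∨ b = m ∧ c = m - 1
    · exact Or.inl (hp h1)
    · obtain ⟨v', h3, h4, h5, h6⟩ := hv a b (by omega) (by omega) (by omega) (by omega) (by omega)
        (by omega) (by omega)
      refine Or.inr ⟨[(a, b)], v', [], h3, h4, rfl, Or.inr ⟨rfl, ?_⟩, Or.inl rfl⟩
      by_cases h7 : b = m
      · rw [h6 h7]
        exact toLex_lt_iff.mpr (by omega)
      · rw [h5 (by omega)]
        exact toLex_lt_iff.mpr (by omega)

/-- A triangle `(a, b), (a, d), (c, d)` is paired with its first edge if `c` is as large as `d`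
allows; otherwise its first edge is paired with another triangle. Its long edge `(a, b), (c, d)` is
then paired with the triangle through the larger corner `(c, b)`, unless `b = c`, where that corner
is missing, or `d = m`, where that triangle is already taken: in these cases the long edge is
paired with the given triangle. -/
theorem settled_upper {m a b c d : ℕ} (h : IsMatrix m [(a, b), (a, d), (c, d)]) :
    Settled m [] (a, b) [(a, d), (c, d)] ∧ Settled m [(a, b)] (a, d) [(c, d)] ∧
      Settled m [(a, b), (a, d)] (c, d) [] := by
  have h' := isMatrix_upper.mp h
  by_cases h1 : c = m ∨ d = m ∧ c = m - 1
  · have hp : Step m [(a, b), (a, d)] (c, d) [] := by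
      rcases h1 with rfl | ⟨rfl, rfl⟩
      · exact .a _ _ _ (by omega) (by omega)
      · exact .b _ _ (by omega)
    exact ⟨Or.inr ⟨[(a, b), (a, d)], (c, d), [], hp, h, rfl, Or.inl Nat.zero_lt_two, Or.inr rfl⟩,
      Or.inr ⟨[(a, b), (a, d)], (c, d), [], hp, h, rfl, Or.inl Nat.one_lt_two, Or.inr rfl⟩,
      Or.inl hp⟩
  refine ⟨?_, ?_, ?_⟩
  · by_cases h2 : d = m
    · exact Or.inr ⟨[(a, b)], (a, d), [(c, d)],
        .f _ _ _ _ (by omega) (by omega) (by omega) (by omega), h, rfl, Or.inl Nat.zero_lt_one,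
        Or.inr rfl⟩
    · exact Or.inr ⟨[(a, d), (c, d)], (c, m), [], .c _ _ _ (by omega) (by omega),
        isMatrix_lower.mpr (by omega), rfl, Or.inl Nat.zero_lt_two, Or.inl rfl⟩
  · by_cases h2 : d = m ∨ b = c
    · exact Or.inl (.f _ _ _ _ (by omega) (by omega) (by omega) (by omega))
    · exact Or.inr ⟨[(a, b)], (c, b), [(c, d)],
        .e _ _ _ _ (by omega) (by omega) (by omega) (by omega), isMatrix_lower.mpr (by omega), rfl,
        Or.inr ⟨rfl, toLex_lt_iff.mpr (by omega)⟩, Or.inl rfl⟩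
  · by_cases h2 : d = m
    · subst h2
      exact Or.inr ⟨[(a, b), (a, d)], (d - 1, d), [], .b _ _ (by omega),
        isMatrix_upper.mpr (by omega), rfl, Or.inr ⟨rfl, toLex_lt_iff.mpr (by omega)⟩, Or.inl rfl⟩
    · exact Or.inr ⟨[(a, b), (a, d)], (m, d), [], .a _ _ _ (by omega) (by omega),
        isMatrix_upper.mpr (by omega), rfl, Or.inr ⟨rfl, toLex_lt_iff.mpr (by omega)⟩, Or.inl rfl⟩

/-- A triangle `(a, b), (c, b), (c, d)` is paired with its first edge if `d` is as large as `c`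
allows, and with its long edge `(a, b), (c, d)` otherwise. -/
theorem settled_lower {m a b c d : ℕ} (h : IsMatrix m [(a, b), (c, b), (c, d)]) :
    Settled m [] (a, b) [(c, b), (c, d)] ∧ Settled m [(a, b)] (c, b) [(c, d)] ∧
      Settled m [(a, b), (c, b)] (c, d) [] := by
  have h' := isMatrix_lower.mp h
  by_cases h1 : d = m ∨ c = m ∧ d = m - 1
  · have hp : Step m [(a, b), (c, b)] (c, d) [] := by
      rcases h1 with rfl | ⟨rfl, rfl⟩
      · exact .c _ _ _ (by omega) (by omega)
      · exact .d _ _ (by omega)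
    exact ⟨Or.inr ⟨[(a, b), (c, b)], (c, d), [], hp, h, rfl, Or.inl Nat.zero_lt_two, Or.inr rfl⟩,
      Or.inr ⟨[(a, b), (c, b)], (c, d), [], hp, h, rfl, Or.inl Nat.one_lt_two, Or.inr rfl⟩,
      Or.inl hp⟩
  have he : Step m [(a, b)] (c, b) [(c, d)] :=
    .e _ _ _ _ (by omega) (by omega) (by omega) (by omega)
  refine ⟨?_, Or.inl he, ?_⟩
  · by_cases h2 : c = m
    · exact Or.inr ⟨[(a, b)], (c, b), [(c, d)], he, h, rfl, Or.inl Nat.zero_lt_one, Or.inr rfl⟩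
    · exact Or.inr ⟨[(c, b), (c, d)], (m, d), [], .a _ _ _ (by omega) (by omega),
        isMatrix_upper.mpr (by omega), rfl, Or.inl Nat.zero_lt_two, Or.inl rfl⟩
  · by_cases h2 : c = m
    · subst h2
      exact Or.inr ⟨[(a, b), (c, b)], (c, c - 1), [], .d _ _ (by omega),
        isMatrix_lower.mpr (by omega), rfl, Or.inr ⟨rfl, toLex_lt_iff.mpr (by omega)⟩, Or.inl rfl⟩
    · exact Or.inr ⟨[(a, b), (c, b)], (c, m), [], .c _ _ _ (by omega) (by omega),
        isMatrix_lower.mpr (by omega), rfl, Or.inr ⟨rfl, toLex_lt_iff.mpr (by omega)⟩, Or.inl rfl⟩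

theorem settled_of_pair {m : ℕ} {p q v : ℕ × ℕ} {pre post : List (ℕ × ℕ)}
    (h : Settled m [] p [q] ∧ Settled m [p] q []) (hl : pre ++ v :: post = [p, q]) :
    Settled m pre v post := by
  match pre, hl with
  | [], hl =>
    cases hl
    exact h.1
  | [_], hl =>
    cases hl
    exact h.2
  | _ :: _ :: _, hl => simp at hl

theorem settled_of_triple {m : ℕ} {p q r v : ℕ × ℕ} {pre post : List (ℕ × ℕ)}
    (h : Settled m [] p [q, r] ∧ Settled m [p] q [r] ∧ Settled m [p, q] r [])
    (hl : pre ++ v :: post = [p, q, r]) : Settled m pre v post := by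
  match pre, hl with
  | [], hl =>
    cases hl
    exact h.1
  | [_], hl =>
    cases hl
    exact h.2.1
  | [_, _], hl =>
    cases hl
    exact h.2.2
  | _ :: _ :: _ :: _, hl => simp at hl

/-- Every candidate on `C m` is settled. The smaller face has to be nonempty. -/
theorem IsMatrix.settled {m : ℕ} (hm : 4 ≤ m) {pre post : List (ℕ × ℕ)} {v : ℕ × ℕ}
    (h : IsMatrix m (pre ++ v :: post)) (hne : pre ++ post ≠ []) : Settled m pre v post := by
  rcases h.shape with ⟨a, b, hl⟩ | ⟨a, b, c, d, hl⟩ | ⟨a, b, c, d, hl⟩ | ⟨a, b, c, d, hl⟩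
  · refine absurd (List.length_eq_zero_iff.mp ?_) hne
    have := congrArg List.length hl
    simp only [List.length_append, List.length_cons, List.length_nil] at this ⊢
    omega
  · exact settled_of_pair (settled_edge hm (hl ▸ h)) hl
  · exact settled_of_triple (settled_upper (hl ▸ h)) hl
  · exact settled_of_triple (settled_lower (hl ▸ h)) hl

theorem Step.eq_of_left_eq {m : ℕ} {pre post pre' post' : List (ℕ × ℕ)} {v v' : ℕ × ℕ}
    (h : Step m pre v post) (h' : Step m pre' v' post') (hl : IsMatrix m (pre ++ v :: post))
    (hl' : IsMatrix m (pre' ++ v' :: post')) (he : pre ++ post = pre' ++ post') : v = v' := by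
  cases h <;> cases h' <;>
    simp only [List.cons_append, List.nil_append, List.cons.injEq, Prod.mk.injEq, reduceCtorEq,
      isMatrix_two, isMatrix_three, and_false, and_true, true_or, or_true,
      true_and] at hl hl' he ⊢ <;> omega

theorem Step.eq_of_right_eq {m : ℕ} {pre post pre' post' : List (ℕ × ℕ)} {v v' : ℕ × ℕ}
    (h : Step m pre v post) (h' : Step m pre' v' post') (hl : IsMatrix m (pre ++ v :: post))
    (hl' : IsMatrix m (pre' ++ v' :: post')) (he : pre ++ v :: post = pre' ++ v' :: post') :
    v = v' := by
  cases h <;> cases h' <;>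
    simp only [List.cons_append, List.nil_append, List.cons.injEq, Prod.mk.injEq, reduceCtorEq,
      isMatrix_two, isMatrix_three, and_false, and_true, true_or, or_true,
      true_and] at hl hl' he ⊢ <;> omega

theorem Step.left_ne_right {m : ℕ} {pre post pre' post' : List (ℕ × ℕ)} {v v' : ℕ × ℕ}
    (h : Step m pre v post) (h' : Step m pre' v' post') (hl : IsMatrix m (pre ++ v :: post))
    (hl' : IsMatrix m (pre' ++ v' :: post')) : pre ++ post ≠ pre' ++ v' :: post' := by
  intro he
  cases h <;> cases h' <;>
    simp only [List.cons_append, List.nil_append, List.cons.injEq, Prod.mk.injEq, reduceCtorEq,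
      isMatrix_two, isMatrix_three, and_false, and_true, true_or, or_true,
      true_and] at hl hl' he <;> omega

/-- The listed pairings as a relation between the smaller face and the new vertex. -/
def IsPairing (m : ℕ) (α : Finset (ℕ ×ₗ ℕ)) (v : ℕ ×ₗ ℕ) : Prop :=
  ∃ pre post, Step m pre (ofLex v) post ∧ IsMatrix m (pre ++ ofLex v :: post) ∧
    α = columnSet (pre ++ post)

theorem isEnd_columnSet {pre post : List (ℕ × ℕ)} {v : ℕ ×ₗ ℕ} {σ : Finset (ℕ ×ₗ ℕ)} :
    IsEnd σ (columnSet (pre ++ post)) v ↔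
      σ = columnSet (pre ++ post) ∨ σ = columnSet (pre ++ ofLex v :: post) := by
  rw [← insert_columnSet]
  rfl

theorem mem_faces_toFinset {m : ℕ} {σ : Finset (ℕ ×ₗ ℕ)} :
    σ ∈ (Set.toFinite (C m).faces).toFinset ↔ ∃ l, IsMatrix m l ∧ σ = columnSet l := by
  rw [Set.Finite.mem_toFinset]
  exact ⟨exists_isMatrix, fun ⟨l, hl, h⟩ => h ▸ hl.columnSet_mem⟩

/-- The listed pairings form a matching in which every other candidate is blocked by an earlier
pairing. -/
theorem isGreedy_isPairing {m : ℕ} (hm : 4 ≤ m) :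
    IsGreedy (Set.toFinite (C m).faces).toFinset (IsPairing m) where
  left_mem := by
    rintro _ v ⟨pre, post, h1, h2, rfl⟩
    exact mem_faces_toFinset.mpr ⟨_, h2.subset h1.append_ne_nil, rfl⟩
  right_mem := by
    rintro _ v ⟨pre, post, h1, h2, rfl⟩
    exact mem_faces_toFinset.mpr ⟨_, h2, insert_columnSet pre post (ofLex v)⟩
  notMem := by
    rintro _ v ⟨pre, post, h1, h2, rfl⟩
    exact notMem_columnSet h2.2.1
  eq_of_isEnd := by
    rintro _ v _ v' σ ⟨pre, post, h1, h2, rfl⟩ ⟨pre', post', h1', h2', rfl⟩ hσ hσ'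
    rw [isEnd_columnSet] at hσ hσ'
    have h3 := h2.subset h1.append_ne_nil
    have h3' := h2'.subset h1'.append_ne_nil
    rcases hσ with rfl | rfl <;> rcases hσ' with h | h
    · exact ⟨h, h1.eq_of_left_eq h1' h2 h2' (columnSet_injOn h3.2.1 h3'.2.1 h)⟩
    · exact absurd (columnSet_injOn h3.2.1 h2'.2.1 h) (h1.left_ne_right h1' h2 h2')
    · exact absurd (columnSet_injOn h2.2.1 h3'.2.1 h).symm (h1'.left_ne_right h1 h2' h2)
    · obtain rfl : v = v' := h1.eq_of_right_eq h1' h2 h2' (columnSet_injOn h2.2.1 h2'.2.1 h)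
      refine ⟨?_, rfl⟩
      -- both smaller faces arise from the common larger one by deleting `v`
      have hv : ∀ {pre post}, IsMatrix m (pre ++ ofLex v :: post) →
          columnSet (pre ++ post) = (columnSet (pre ++ ofLex v :: post)).erase v := by
        intro pre post hl
        rw [← insert_columnSet]
        exact (Finset.erase_insert (notMem_columnSet hl.2.1)).symm
      rw [hv h2, hv h2', h]
  blocked := by
    intro α v hα hv hβ hM
    obtain ⟨l, hl, hβl⟩ := mem_faces_toFinset.mp hβ
    have hvl : ofLex v ∈ l := by
      rw [← mem_columnSet, ← hβl]
      exact Finset.mem_insert_self _ _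
    obtain ⟨pre, post, rfl⟩ := List.append_of_mem hvl
    have hαl : α = columnSet (pre ++ post) := by
      rw [← Finset.erase_insert hv, hβl, ← insert_columnSet]
      exact Finset.erase_insert (notMem_columnSet hl.2.1)
    have hne : pre ++ post ≠ [] := by
      intro h
      obtain ⟨l', hl', hαl'⟩ := mem_faces_toFinset.mp hα
      refine hl'.1 (columnSet_injOn hl'.2.1 (l' := []) (by simp) ?_)
      rw [← hαl', hαl, h]
    subst hαl
    rcases hl.settled hm hne with h | ⟨pre', v', post', h1, h2, h3, h4, h5⟩
    · exact absurd ⟨pre, post, h, hl, rfl⟩ hM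
    · have hE : Earlier (columnSet (pre' ++ post')) (toLex v') (columnSet (pre ++ post)) v := by
        refine Or.inr ⟨?_, ?_⟩
        · rw [card_columnSet (h2.subset h1.append_ne_nil).2.1, card_columnSet (hl.subset hne).2.1,
            h3]
        · rw [insert_columnSet, position_columnSet h2.2.1]
          rw [show v = toLex (ofLex v) from rfl, insert_columnSet, position_columnSet hl.2.1]
          exact h4
      have hM' : IsPairing m (columnSet (pre' ++ post')) (toLex v') := ⟨pre', post', h1, h2, rfl⟩
      rcases h5 with h5 | h5
      · refine ⟨_, _, columnSet (pre ++ post), hM', hE, Or.inl rfl, Or.inl ?_⟩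
        rw [h5]
      · refine ⟨_, _, columnSet (pre ++ ofLex v :: post), hM', hE, Or.inr ?_, Or.inr ?_⟩
        · exact (insert_columnSet _ _ _).symm
        · rw [insert_columnSet, h5]

theorem mem_gradientField_C {m : ℕ} (hm : 4 ≤ m) {α β : Finset (ℕ ×ₗ ℕ)} :
    (α, β) ∈ gradientField (C m) ↔ ∃ pre v post, Step m pre v post ∧
      IsArray m (pre ++ post) α ∧ IsArray m (pre ++ v :: post) β := by
  have hF : ∅ ∉ (Set.toFinite (C m).faces).toFinset := fun h =>
    Finset.not_nonempty_empty ((C m).isRelLowerSet_faces ((Set.Finite.mem_toFinset _).mp h)).1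
  rw [gradientField, (isGreedy_isPairing hm).mem_pairs_iff hF]
  simp only [isArray_iff]
  constructor
  · rintro ⟨_, v, ⟨pre, post, h1, h2, rfl⟩, h⟩
    rw [Prod.mk.injEq] at h
    obtain ⟨rfl, rfl⟩ := h
    exact ⟨pre, ofLex v, post, h1, ⟨h2.subset h1.append_ne_nil, rfl⟩, h2,
      insert_columnSet pre post (ofLex v)⟩
  · rintro ⟨pre, v, post, h1, ⟨-, rfl⟩, h2, rfl⟩
    exact ⟨_, toLex v, ⟨pre, post, h1, h2, rfl⟩, by rw [insert_columnSet]⟩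

/-! ### The critical faces -/

/-- The columns of the critical faces of `C m`. The conditions that make the columns a simplex are
not included. -/
inductive CriticalColumns (m : ℕ) : List (ℕ × ℕ) → Prop
  | j : CriticalColumns m [(m, m - 1)]
  | k₁ (a b : ℕ) (h : (a = m - 1 ∧ b + 1 < m - 1) ∨ (a < m - 1 ∧ b ≤ m - 1)) :
      CriticalColumns m [(a, b), (m - 1, m)]
  | k₂ (b d : ℕ) (hd : d < m - 1) : CriticalColumns m [(m, b), (m, d)]
  | k₃ (a c : ℕ) (hc : c < m - 1) : CriticalColumns m [(a, m), (c, m)]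
  | l (a b c d : ℕ) (hbc : b ≠ c) (hc : c < m) (hd : d < m) :
      CriticalColumns m [(a, b), (a, d), (c, d)]

theorem CriticalColumns.ne_of_step {m : ℕ} {l pre post : List (ℕ × ℕ)} {v : ℕ × ℕ}
    (hl : CriticalColumns m l) (h : Step m pre v post) (hM : IsMatrix m l)
    (hM' : IsMatrix m (pre ++ v :: post)) : l ≠ pre ++ post ∧ l ≠ pre ++ v :: post := by
  refine ⟨fun he => ?_, fun he => ?_⟩ <;> cases hl <;> cases h <;>
    simp only [List.cons_append, List.nil_append, List.cons.injEq, Prod.mk.injEq, reduceCtorEq,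
      isMatrix_one, isMatrix_two, isMatrix_three, and_false, and_true, true_or, or_true,
      true_and] at hM hM' he <;> omega

theorem IsMatrix.criticalColumns_or_step {m : ℕ} (hm : 4 ≤ m) {l : List (ℕ × ℕ)}
    (h : IsMatrix m l) : CriticalColumns m l ∨ ∃ pre v post, Step m pre v post ∧
      IsMatrix m (pre ++ v :: post) ∧ (l = pre ++ post ∨ l = pre ++ v :: post) := by
  rcases h.shape with ⟨a, b, rfl⟩ | ⟨a, b, c, d, rfl⟩ | ⟨a, b, c, d, rfl⟩ | ⟨a, b, c, d, rfl⟩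
  · rw [isMatrix_one] at h
    by_cases h1 : b = m
    · subst h1
      by_cases h2 : a = b - 1
      · subst h2
        exact Or.inr ⟨[], _, _, .i, isMatrix_two.mpr (by omega), Or.inl rfl⟩
      · exact Or.inr ⟨_, _, _, .h a (by omega), isMatrix_two.mpr (by omega), Or.inl rfl⟩
    by_cases h2 : a = m ∧ b = m - 1
    · obtain ⟨rfl, rfl⟩ := h2
      exact Or.inl .j
    · exact Or.inr ⟨_, _, _, .g a b (by omega), isMatrix_two.mpr (by omega), Or.inl rfl⟩
  · have h' := isMatrix_two.mp h
    by_cases hac : a = c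
    · subst hac
      by_cases hd : d = m
      · subst hd
        by_cases ha : a = d - 1
        · subst ha
          by_cases hb : b = d - 2
          · subst hb
            exact Or.inr ⟨[], _, _, .i, h, Or.inr rfl⟩
          · exact Or.inl (.k₁ _ _ (by omega))
        · exact Or.inr ⟨_, _, _, .b a b (by omega), isMatrix_upper.mpr (by omega), Or.inl rfl⟩
      · by_cases ha : a = m
        · subst ha
          by_cases hd' : d = a - 1
          · subst hd'
            exact Or.inr ⟨_, _, _, .g a b (by omega), h, Or.inr rfl⟩
          · exact Or.inl (.k₂ _ _ (by omega))
        · exact Or.inr ⟨_, _, _, .a a b d (by omega) (by omega), isMatrix_upper.mpr (by omega),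
            Or.inl rfl⟩
    by_cases hbd : b = d
    · subst hbd
      by_cases hc : c = m
      · subst hc
        by_cases hb : b = c - 1
        · subst hb
          exact Or.inr ⟨_, _, _, .g a _ (by omega), h, Or.inr rfl⟩
        · exact Or.inr ⟨_, _, _, .d a b (by omega), isMatrix_lower.mpr (by omega), Or.inl rfl⟩
      · by_cases hb : b = m
        · subst hb
          by_cases hc' : c = b - 1
          · subst hc'
            exact Or.inr ⟨_, _, _, .h a (by omega), h, Or.inr rfl⟩
          · exact Or.inl (.k₃ _ _ (by omega))
        · exact Or.inr ⟨_, _, _, .c a b c (by omega) (by omega), isMatrix_lower.mpr (by omega),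
            Or.inl rfl⟩
    by_cases hd : d = m
    · by_cases hc : c = m - 1
      · subst hd hc
        exact Or.inl (.k₁ _ _ (by omega))
      · exact Or.inr ⟨[(a, b)], _, _, .f a b c d (by omega) (by omega) (by omega) (by omega),
          isMatrix_upper.mpr (by omega), Or.inl rfl⟩
    by_cases hc : c = m ∧ d = m - 1
    · obtain ⟨rfl, rfl⟩ := hc
      exact Or.inr ⟨_, _, _, .g a b (by omega), h, Or.inr rfl⟩
    by_cases hbc : b = c
    · exact Or.inr ⟨[(a, b)], _, _, .f a b c d (by omega) (by omega) (by omega) (by omega),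
        isMatrix_upper.mpr (by omega), Or.inl rfl⟩
    · exact Or.inr ⟨[(a, b)], _, _, .e a b c d (by omega) (by omega) (by omega) (by omega),
        isMatrix_lower.mpr (by omega), Or.inl rfl⟩
  · by_cases hcr : b ≠ c ∧ c < m ∧ d < m
    · exact Or.inl (.l _ _ _ _ hcr.1 hcr.2.1 hcr.2.2)
    have h' := isMatrix_upper.mp h
    by_cases hc : c = m
    · subst hc
      exact Or.inr ⟨_, _, _, .a a b d (by omega) (by omega), h, Or.inr rfl⟩
    by_cases hcd : c = m - 1 ∧ d = m
    · obtain ⟨rfl, rfl⟩ := hcd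
      exact Or.inr ⟨_, _, _, .b a b (by omega), h, Or.inr rfl⟩
    · exact Or.inr ⟨[(a, b)], _, _, .f a b c d (by omega) (by omega) (by omega) (by omega), h,
        Or.inr rfl⟩
  · have h' := isMatrix_lower.mp h
    by_cases hd : d = m
    · subst hd
      exact Or.inr ⟨_, _, _, .c a b c (by omega) (by omega), h, Or.inr rfl⟩
    by_cases hcd : c = m ∧ d = m - 1
    · obtain ⟨rfl, rfl⟩ := hcd
      exact Or.inr ⟨_, _, _, .d a b (by omega), h, Or.inr rfl⟩
    · exact Or.inr ⟨[(a, b)], _, _, .e a b c d (by omega) (by omega) (by omega) (by omega), h,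
        Or.inr rfl⟩

theorem isCritical_C_iff {m : ℕ} (hm : 4 ≤ m) {σ : Finset (ℕ ×ₗ ℕ)} :
    IsCritical (C m) (gradientField (C m)) σ ↔ ∃ l, CriticalColumns m l ∧ IsArray m l σ := by
  simp only [IsCritical, mem_gradientField_C hm, isArray_iff]
  constructor
  · rintro ⟨hσ, h1, h2⟩
    obtain ⟨l, hl, rfl⟩ := exists_isMatrix hσ
    refine ⟨l, ?_, hl, rfl⟩
    rcases hl.criticalColumns_or_step hm with h | ⟨pre, v, post, h3, h4, rfl | rfl⟩
    · exact h
    · exact absurd ⟨pre, v, post, h3, ⟨hl, rfl⟩, h4, rfl⟩ (h1 _)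
    · exact absurd ⟨pre, v, post, h3, ⟨h4.subset h3.append_ne_nil, rfl⟩, h4, rfl⟩ (h2 _)
  · rintro ⟨l, hc, hl, rfl⟩
    refine ⟨hl.columnSet_mem, ?_, ?_⟩
    · rintro _ ⟨pre, v, post, h1, ⟨h2, h3⟩, h4, -⟩
      exact (hc.ne_of_step h1 hl h4).1 (columnSet_injOn hl.2.1 h2.2.1 h3)
    · rintro _ ⟨pre, v, post, h1, -, h4, h5⟩
      exact (hc.ne_of_step h1 hl h4).2 (columnSet_injOn hl.2.1 h4.2.1 h5)

theorem mem_criticalFaces_C {m : ℕ} (hm : 4 ≤ m) {p : ℕ} {σ : Finset (ℕ ×ₗ ℕ)} :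
    σ ∈ criticalFaces (C m) p ↔
      ∃ l, CriticalColumns m l ∧ IsMatrix m l ∧ l.length = p + 1 ∧ σ = columnSet l := by
  classical
  rw [criticalFaces, Finset.mem_filter, isCritical_C_iff hm, mem_facesOfDim, mem_faces_toFinset]
  simp only [isArray_iff]
  constructor
  · rintro ⟨⟨-, h1⟩, l, h2, h3, rfl⟩
    exact ⟨l, h2, h3, by rw [← h1, card_columnSet h3.2.1], rfl⟩
  · rintro ⟨l, h1, h2, h3, rfl⟩
    exact ⟨⟨⟨l, h2, rfl⟩, by rw [card_columnSet h2.2.1, h3]⟩, l, h1, h2, rfl⟩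

/-! ### Counting the critical faces -/

theorem card_criticalFaces_C_zero {m : ℕ} (hm : 4 ≤ m) : (criticalFaces (C m) 0).card = 1 := by
  refine Finset.card_eq_one.mpr ⟨columnSet [(m, m - 1)], ?_⟩
  ext σ
  rw [mem_criticalFaces_C hm, Finset.mem_singleton]
  constructor
  · rintro ⟨l, h1, -, h2, rfl⟩
    cases h1 <;> simp at h2 ⊢
  · rintro rfl
    exact ⟨_, .j, isMatrix_one.mpr (by omega), rfl, rfl⟩

theorem card_criticalFaces_C_one {m : ℕ} (hm : 4 ≤ m) :
    ((criticalFaces (C m) 1).card : ℚ) = 2 * ((m : ℚ) - 2) ^ 2 - 1 := by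
  set A : Finset (ℕ × ℕ) := (Finset.Icc 1 (m - 1)).offDiag.erase (m - 1, m - 2) with hA
  set B : Finset (ℕ × ℕ) := (Finset.Icc 1 (m - 2)).offDiag with hB
  set f : ℕ × ℕ → List (ℕ × ℕ) := fun p => [p, (m - 1, m)] with hf
  -- the edges with upper row `m, m` and those with lower row `m, m` are together indexed by
  -- the ordered pairs of distinct numbers: the increasing and the decreasing ones
  set g : ℕ × ℕ → List (ℕ × ℕ) :=
    fun p => if p.1 < p.2 then [(m, p.1), (m, p.2)] else [(p.2, m), (p.1, m)] with hg
  have hmemA : ∀ a b, (a, b) ∈ A ↔ 1 ≤ a ∧ a ≤ m - 1 ∧ 1 ≤ b ∧ b ≤ m - 1 ∧ a ≠ b ∧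
      ¬ (a = m - 1 ∧ b = m - 2) := fun a b => by
    simp only [hA, Finset.mem_erase, Finset.mem_offDiag, Finset.mem_Icc, ne_eq, Prod.mk.injEq]
    tauto
  have hmemB : ∀ a b, (a, b) ∈ B ↔ 1 ≤ a ∧ a ≤ m - 2 ∧ 1 ≤ b ∧ b ≤ m - 2 ∧ a ≠ b := fun a b => by
    simp only [hB, Finset.mem_offDiag, Finset.mem_Icc]
    tauto
  have hlist : ∀ l, l ∈ A.image f ∪ B.image g ↔
      CriticalColumns m l ∧ IsMatrix m l ∧ l.length = 2 := by
    intro l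
    rw [Finset.mem_union, Finset.mem_image, Finset.mem_image]
    constructor
    · rintro (⟨⟨a, b⟩, h, rfl⟩ | ⟨⟨a, b⟩, h, rfl⟩)
      · rw [hmemA] at h
        exact ⟨.k₁ _ _ (by omega), isMatrix_two.mpr (by omega), rfl⟩
      · rw [hmemB] at h
        simp only [hg]
        split_ifs
        · exact ⟨.k₂ _ _ (by omega), isMatrix_two.mpr (by omega), rfl⟩
        · exact ⟨.k₃ _ _ (by omega), isMatrix_two.mpr (by omega), rfl⟩
    · rintro ⟨h1, h2, h3⟩
      cases h1 with
      | j => simp at h3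
      | k₁ a b h =>
        rw [isMatrix_two] at h2
        exact Or.inl ⟨(a, b), (hmemA _ _).mpr (by omega), rfl⟩
      | k₂ b d hd =>
        rw [isMatrix_two] at h2
        exact Or.inr ⟨(b, d), (hmemB _ _).mpr (by omega), if_pos (by omega)⟩
      | k₃ a c hc =>
        rw [isMatrix_two] at h2
        exact Or.inr ⟨(c, a), (hmemB _ _).mpr (by omega), if_neg (by omega)⟩
      | l a b c d => simp at h3
  have hfaces : criticalFaces (C m) 1 = (A.image f ∪ B.image g).image columnSet := by
    ext σ
    simp only [mem_criticalFaces_C hm, Finset.mem_image (f := columnSet), hlist]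
    exact ⟨fun ⟨l, h1, h2, h3, h4⟩ => ⟨l, ⟨h1, h2, h3⟩, h4.symm⟩,
      fun ⟨l, ⟨h1, h2, h3⟩, h4⟩ => ⟨l, h1, h2, h3, h4.symm⟩⟩
  have hdisj : Disjoint (A.image f) (B.image g) := by
    rw [Finset.disjoint_left]
    simp only [Finset.mem_image]
    rintro _ ⟨⟨a, b⟩, h, rfl⟩ ⟨⟨x, y⟩, h', he⟩
    rw [hmemB] at h'
    simp only [hf, hg] at he
    split_ifs at he <;> simp only [List.cons.injEq, Prod.mk.injEq] at he <;> omega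
  have hfinj : Set.InjOn f A := fun p _ q _ h => (List.cons.inj h).1
  have hginj : Set.InjOn g B := by
    rintro ⟨a, b⟩ h ⟨x, y⟩ h' he
    rw [Finset.mem_coe, hmemB] at h h'
    simp only [hg] at he
    rw [Prod.mk.injEq]
    split_ifs at he <;> simp only [List.cons.injEq, Prod.mk.injEq] at he <;> omega
  rw [hfaces, Finset.card_image_of_injOn, Finset.card_union_of_disjoint hdisj,
    Finset.card_image_of_injOn hfinj, Finset.card_image_of_injOn hginj, hA, hB,
    Finset.card_erase_of_mem, Finset.offDiag_card, Finset.offDiag_card, Nat.card_Icc, Nat.card_Icc]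
  · obtain ⟨k, rfl⟩ := Nat.exists_eq_add_of_le hm
    have e1 : 4 + k - 1 + 1 - 1 = k + 3 := by omega
    have e2 : 4 + k - 2 + 1 - 1 = k + 2 := by omega
    have e3 : (k + 3) * (k + 3) - (k + 3) - 1 = k * k + 5 * k + 5 := by
      rw [Nat.sub_sub]
      refine Nat.sub_eq_of_eq_add ?_
      ring
    have e4 : (k + 2) * (k + 2) - (k + 2) = k * k + 3 * k + 2 := by
      refine Nat.sub_eq_of_eq_add ?_
      ring
    rw [e1, e2, e3, e4]
    push_cast
    ring
  · simp only [Finset.mem_offDiag, Finset.mem_Icc]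
    omega
  · exact fun l h l' h' he => columnSet_injOn ((hlist l).mp h).2.1.2.1 ((hlist l').mp h').2.1.2.1 he

theorem pair_eq_pair_of_lt {a b c d : ℕ} (hab : a < b) (hcd : c < d)
    (h : ({a, b} : Finset ℕ) = {c, d}) : a = c ∧ b = d := by
  simp only [Finset.ext_iff, Finset.mem_insert, Finset.mem_singleton] at h
  have := h a
  have := h b
  have := h c
  have := h d
  omega

theorem exists_lt_of_card_eq_two {s : Finset ℕ} (h : s.card = 2) : ∃ a b, a < b ∧ s = {a, b} := by
  obtain ⟨a, b, hab, rfl⟩ := Finset.card_eq_two.mp h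
  rcases hab.lt_or_gt with h | h
  · exact ⟨a, b, h, rfl⟩
  · exact ⟨b, a, h, Finset.pair_comm a b⟩

theorem card_criticalFaces_C_two {m : ℕ} (hm : 4 ≤ m) :
    ((criticalFaces (C m) 2).card : ℚ) =
      ((m : ℚ) - 1) * ((m : ℚ) - 2) * ((m : ℚ) - 3) * ((m : ℚ) - 4) / 4 := by
  -- such a face amounts to the disjoint pairs `{a, c}` and `{b, d}` of entries of its rows
  set N := Finset.Icc 1 (m - 1) with hN
  have hmem : ∀ σ, σ ∈ criticalFaces (C m) 2 ↔ ∃ a b c d, a < c ∧ b < d ∧ 1 ≤ a ∧ c ≤ m - 1 ∧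
      1 ≤ b ∧ d ≤ m - 1 ∧ a ≠ b ∧ a ≠ d ∧ c ≠ b ∧ c ≠ d ∧
      σ = columnSet [(a, b), (a, d), (c, d)] := by
    intro σ
    rw [mem_criticalFaces_C hm]
    constructor
    · rintro ⟨l, h1, h2, h3, rfl⟩
      cases h1 with
      | l a b c d =>
        rw [isMatrix_upper] at h2
        exact ⟨a, b, c, d, by omega, by omega, by omega, by omega, by omega, by omega, by omega,
          by omega, by omega, by omega, rfl⟩
      | _ => simp at h3
    · rintro ⟨a, b, c, d, h1, h2, h3, h4, h5, h6, h7, h8, h9, h10, rfl⟩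
      exact ⟨_, .l a b c d (by omega) (by omega) (by omega), isMatrix_upper.mpr (by omega), rfl,
        rfl⟩
  have hrow : ∀ a b c d : ℕ,
      (columnSet [(a, b), (a, d), (c, d)]).image (fun p => (ofLex p).1) = {a, c} ∧
      (columnSet [(a, b), (a, d), (c, d)]).image (fun p => (ofLex p).2) = {b, d} := by
    intro a b c d
    simp [columnSet]
  have hcard : (criticalFaces (C m) 2).card =
      ((N.powersetCard 2).sigma fun s => (N \ s).powersetCard 2).card := by
    refine Finset.card_bij (fun σ _ => ⟨σ.image (fun p => (ofLex p).1),
      σ.image (fun p => (ofLex p).2)⟩) ?_ ?_ ?_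
    · intro σ hσ
      obtain ⟨a, b, c, d, h1, h2, h3, h4, h5, h6, h7, h8, h9, h10, rfl⟩ := (hmem σ).mp hσ
      rw [(hrow a b c d).1, (hrow a b c d).2]
      simp only [Finset.mem_sigma, Finset.mem_powersetCard, Finset.card_pair h1.ne,
        Finset.card_pair h2.ne, and_true, Finset.insert_subset_iff, Finset.singleton_subset_iff,
        hN, Finset.mem_sdiff, Finset.mem_Icc, Finset.mem_insert, Finset.mem_singleton]
      omega
    · intro σ hσ τ hτ he
      obtain ⟨a, b, c, d, h1, h2, -, -, -, -, -, -, -, -, rfl⟩ := (hmem σ).mp hσ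
      obtain ⟨x, y, z, w, h3, h4, -, -, -, -, -, -, -, -, rfl⟩ := (hmem τ).mp hτ
      rw [(hrow a b c d).1, (hrow a b c d).2, (hrow x y z w).1, (hrow x y z w).2] at he
      simp only [Sigma.mk.injEq, heq_eq_eq] at he
      obtain ⟨rfl, rfl⟩ := pair_eq_pair_of_lt h1 h3 he.1
      obtain ⟨rfl, rfl⟩ := pair_eq_pair_of_lt h2 h4 he.2
      rfl
    · rintro ⟨s, t⟩ hst
      simp only [Finset.mem_sigma, Finset.mem_powersetCard] at hst
      obtain ⟨⟨hs, hs'⟩, ht, ht'⟩ := hst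
      obtain ⟨a, c, hac, rfl⟩ := exists_lt_of_card_eq_two hs'
      obtain ⟨b, d, hbd, rfl⟩ := exists_lt_of_card_eq_two ht'
      simp only [Finset.insert_subset_iff, Finset.singleton_subset_iff, hN, Finset.mem_sdiff,
        Finset.mem_Icc, Finset.mem_insert, Finset.mem_singleton] at hs ht
      refine ⟨columnSet [(a, b), (a, d), (c, d)], (hmem _).mpr ⟨a, b, c, d, by omega, by omega,
        by omega, by omega, by omega, by omega, by omega, by omega, by omega, by omega, rfl⟩, ?_⟩
      rw [(hrow a b c d).1, (hrow a b c d).2]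
  have hsum : ((N.powersetCard 2).sigma fun s => (N \ s).powersetCard 2).card =
      (m - 1).choose 2 * (m - 3).choose 2 := by
    have hNc : N.card = m - 1 := by simp [hN]
    rw [Finset.card_sigma, Finset.sum_const_nat (m := (m - 3).choose 2), Finset.card_powersetCard,
      hNc]
    intro s hs
    rw [Finset.mem_powersetCard] at hs
    rw [Finset.card_powersetCard, Finset.card_sdiff_of_subset hs.1, hNc, hs.2]
    congr 1
  rw [hcard, hsum]
  obtain ⟨k, rfl⟩ := Nat.exists_eq_add_of_le hm
  have e1 : 4 + k - 1 = k + 3 := by omega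
  have e2 : 4 + k - 3 = k + 1 := by omega
  rw [e1, e2, Nat.cast_mul, Nat.cast_choose_two, Nat.cast_choose_two]
  push_cast
  ring

end MunkresModel

open MunkresModel in
theorem proposition4p1 (m : ℕ) (hm : 4 ≤ m) :
    -- the full list of pairings
    (∀ α β : Finset (ℕ ×ₗ ℕ), (α, β) ∈ gradientField (C m) ↔
      -- (a)
      (∃ a b d : ℕ, a < m ∧ d < m ∧
        IsArray m [(a, b), (a, d)] α ∧ IsArray m [(a, b), (a, d), (m, d)] β) ∨
      -- (b)
      (∃ a b : ℕ, a < m - 1 ∧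
        IsArray m [(a, b), (a, m)] α ∧ IsArray m [(a, b), (a, m), (m - 1, m)] β) ∨
      -- (c)
      (∃ a b c : ℕ, b < m ∧ c < m ∧
        IsArray m [(a, b), (c, b)] α ∧ IsArray m [(a, b), (c, b), (c, m)] β) ∨
      -- (d)
      (∃ a b : ℕ, b < m - 1 ∧
        IsArray m [(a, b), (m, b)] α ∧ IsArray m [(a, b), (m, b), (m, m - 1)] β) ∨
      -- (e)
      (∃ a b c d : ℕ, a < c ∧ b < d ∧ b ≠ c ∧ ((c < m ∧ d < m) ∨ (c = m ∧ d + 1 < m)) ∧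
        IsArray m [(a, b), (c, d)] α ∧ IsArray m [(a, b), (c, b), (c, d)] β) ∨
      -- (f)
      (∃ a b c d : ℕ, a < c ∧ b < d ∧ a ≠ d ∧
        ((b = c ∧ c < m ∧ d < m) ∨ (c + 1 < m ∧ d = m)) ∧
        IsArray m [(a, b), (c, d)] α ∧ IsArray m [(a, b), (a, d), (c, d)] β) ∨
      -- (g)
      (∃ a b : ℕ, (b < m - 1 ∨ (a < m - 1 ∧ b = m - 1)) ∧
        IsArray m [(a, b)] α ∧ IsArray m [(a, b), (m, m - 1)] β) ∨
      -- (h)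
      (∃ a : ℕ, a < m - 1 ∧
        IsArray m [(a, m)] α ∧ IsArray m [(a, m), (m - 1, m)] β) ∨
      -- (i)
      (IsArray m [(m - 1, m)] α ∧ IsArray m [(m - 1, m - 2), (m - 1, m)] β)) ∧
    -- the full list of critical faces
    (∀ σ : Finset (ℕ ×ₗ ℕ), IsCritical (C m) (gradientField (C m)) σ ↔
      -- (j)
      IsArray m [(m, m - 1)] σ ∨
      -- (k.1)
      (∃ a b : ℕ, ((a = m - 1 ∧ b + 1 < m - 1) ∨ (a < m - 1 ∧ b ≤ m - 1)) ∧
        IsArray m [(a, b), (m - 1, m)] σ) ∨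
      -- (k.2)
      (∃ b d : ℕ, d < m - 1 ∧ IsArray m [(m, b), (m, d)] σ) ∨
      -- (k.3)
      (∃ a c : ℕ, c < m - 1 ∧ IsArray m [(a, m), (c, m)] σ) ∨
      -- (l)
      (∃ a b c d : ℕ, b ≠ c ∧ c < m ∧ d < m ∧ IsArray m [(a, b), (a, d), (c, d)] σ)) ∧
    -- the number of critical faces in each dimension
    (criticalFaces (C m) 0).card = 1 ∧
    ((criticalFaces (C m) 1).card : ℚ) = 2 * ((m : ℚ) - 2) ^ 2 - 1 ∧
    ((criticalFaces (C m) 2).card : ℚ) =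
      ((m : ℚ) - 1) * ((m : ℚ) - 2) * ((m : ℚ) - 3) * ((m : ℚ) - 4) / 4 := by
  refine ⟨fun α β => ?_, fun σ => ?_, card_criticalFaces_C_zero hm, card_criticalFaces_C_one hm,
    card_criticalFaces_C_two hm⟩
  · rw [mem_gradientField_C hm]
    constructor
    · rintro ⟨pre, v, post, h, hα, hβ⟩
      cases h with
      | a a b d ha hd => exact Or.inl ⟨a, b, d, ha, hd, hα, hβ⟩
      | b a b ha => exact Or.inr (.inl ⟨a, b, ha, hα, hβ⟩)
      | c a b c hb hc => exact Or.inr (.inr (.inl ⟨a, b, c, hb, hc, hα, hβ⟩))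
      | d a b hb => exact Or.inr (.inr (.inr (.inl ⟨a, b, hb, hα, hβ⟩)))
      | e a b c d hac hbd hbc h =>
        exact Or.inr (.inr (.inr (.inr (.inl ⟨a, b, c, d, hac, hbd, hbc, h, hα, hβ⟩))))
      | f a b c d hac hbd had h =>
        exact Or.inr (.inr (.inr (.inr (.inr (.inl ⟨a, b, c, d, hac, hbd, had, h, hα, hβ⟩)))))
      | g a b h => exact Or.inr (.inr (.inr (.inr (.inr (.inr (.inl ⟨a, b, h, hα, hβ⟩))))))
      | h a ha => exact Or.inr (.inr (.inr (.inr (.inr (.inr (.inr (.inl ⟨a, ha, hα, hβ⟩)))))))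
      | i => exact Or.inr (.inr (.inr (.inr (.inr (.inr (.inr (.inr ⟨hα, hβ⟩)))))))
    · rintro (⟨a, b, d, ha, hd, hα, hβ⟩ | ⟨a, b, ha, hα, hβ⟩ | ⟨a, b, c, hb, hc, hα, hβ⟩ |
        ⟨a, b, hb, hα, hβ⟩ | ⟨a, b, c, d, hac, hbd, hbc, h, hα, hβ⟩ |
        ⟨a, b, c, d, hac, hbd, had, h, hα, hβ⟩ | ⟨a, b, h, hα, hβ⟩ | ⟨a, ha, hα, hβ⟩ | ⟨hα, hβ⟩)
      · exact ⟨_, _, _, .a a b d ha hd, hα, hβ⟩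
      · exact ⟨_, _, _, .b a b ha, hα, hβ⟩
      · exact ⟨_, _, _, .c a b c hb hc, hα, hβ⟩
      · exact ⟨_, _, _, .d a b hb, hα, hβ⟩
      · exact ⟨_, _, _, .e a b c d hac hbd hbc h, hα, hβ⟩
      · exact ⟨_, _, _, .f a b c d hac hbd had h, hα, hβ⟩
      · exact ⟨_, _, _, .g a b h, hα, hβ⟩
      · exact ⟨_, _, _, .h a ha, hα, hβ⟩
      · exact ⟨_, _, _, .i, hα, hβ⟩
  · rw [isCritical_C_iff hm]
    constructor
    · rintro ⟨l, hl, hσ⟩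
      cases hl with
      | j => exact Or.inl hσ
      | k₁ a b h => exact Or.inr (.inl ⟨a, b, h, hσ⟩)
      | k₂ b d hd => exact Or.inr (.inr (.inl ⟨b, d, hd, hσ⟩))
      | k₃ a c hc => exact Or.inr (.inr (.inr (.inl ⟨a, c, hc, hσ⟩)))
      | l a b c d hbc hc hd => exact Or.inr (.inr (.inr (.inr ⟨a, b, c, d, hbc, hc, hd, hσ⟩)))
    · rintro (hσ | ⟨a, b, h, hσ⟩ | ⟨b, d, hd, hσ⟩ | ⟨a, c, hc, hσ⟩ | ⟨a, b, c, d, hbc, hc, hd, hσ⟩)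
      · exact ⟨_, .j, hσ⟩
      · exact ⟨_, .k₁ a b h, hσ⟩
      · exact ⟨_, .k₂ b d hd, hσ⟩
      · exact ⟨_, .k₃ a c hc, hσ⟩
      · exact ⟨_, .l a b c d hbc hc hd, hσ⟩
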